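/- Let $0\le b_1<b_2<\infty$. Let $\mathcal A$ be the set of all real-valued $B\in L^\infty(0,1)$ with $b_1\le B(x)\le b_2$ for almost all $x\in(0,1)$. For $B\in\mathcal A$ let $K(B)$ be the set of all $\kappa\in\mathbb C\setminus\{0\}$ (the quasi-eigenvalues of $B$) for which the problem $$y''(x)+\kappa^2B(x)y(x)=0\ \text{ for a.a. } x\in(0,1),\qquad y'(0)=0,\qquad y(1)-\frac{i\,y'(1)}{\kappa}=0$$ has a nonzero solution $y$ in the complex Sobolev space $W^{2,\infty}(0,1)$. Given $\alpha\in\mathbb R$, a number $\kappa$ is called an optimal quasi-eigenvalue for the frequency $\alpha$ if $\kappa=\alpha+i\,I(\alpha)$, where $$I(\alpha)=\min\Big\{\operatorname{Im}\kappa' : \kappa'\in\bigcup_{B\in\mathcal A}K(B),\ \operatorname{Re}\kappa'=\alpha\Big\},$$ and a structure $B\in\mathcal A$ is called optimal for the frequency $\alpha$ if $\alpha+i\,I(\alpha)\in K(B)$. Let $\chi(z)=1$ if $\operatorname{Im}z>0$ and $\chi(z)=0$ if $\operatorname{Im}z\le0$. **Theorem.** Let $\kappa$ be an optimal quasi-eigenvalue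 for a frequency $\alpha\in\mathbb R$. Then there is a nonzero function $y\in W^{2,\infty}(0,1)$ such that $$y''(x)+\kappa^2y(x)\big[b_1+(b_2-b_1)\,\chi(y(x)^2)\big]=0\ \text{ for a.a. } x\in(0,1),\qquad y'(0)=0,\qquad y(1)-\frac{i\,y'(1)}{\kappa}=0,$$ and such that $B(x)=b_1+(b_2-b_1)\,\chi(y(x)^2)$ is an optimal structure for the frequency $\alpha$. -/

import Mathlib

open MeasureTheory Set
open scoped ContDiff

namespace QuasiNormal

/-- `v` is the weak (distributional) derivative of `u` on the interval `(0,1)`, tested against all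
smooth functions with compact support in `(0,1)`. It is only used below for functions `u`, `v`
that are bounded and measurable on `(0,1)`, so that both integrals converge. -/
def HasWeakDeriv (u v : ℝ → ℂ) : Prop :=
  ∀ φ : ℝ → ℝ, ContDiff ℝ ∞ φ → HasCompactSupport φ → tsupport φ ⊆ Ioo 0 1 →
    ∫ x in Ioo (0 : ℝ) 1, ((deriv φ x : ℝ) : ℂ) * u x = -∫ x in Ioo (0 : ℝ) 1, (φ x : ℂ) * v x

/-- `y` belongs to the complex Sobolev space `W^{2,∞}(0,1)`, with weak derivatives `y' = p` and
`y'' = q` in `L^∞(0,1)`. The functions `y` and `p` are the representatives that are continuous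
on `[0,1]`, so that the boundary values of `y` and `y'` make sense; `q` is determined up to a
null set. -/
structure IsW2InfWith (y p q : ℝ → ℂ) : Prop where
  continuousOn : ContinuousOn y (Icc 0 1)
  continuousOn_deriv : ContinuousOn p (Icc 0 1)
  memLp_deriv2 : MemLp q ⊤ (volume.restrict (Ioo 0 1))
  weakDeriv : HasWeakDeriv y p
  weakDeriv2 : HasWeakDeriv p q

/-- `y ∈ W^{2,∞}(0,1)` solves `y'' + κ² B y = 0` a.e. on `(0,1)`, with the boundary conditions
`y'(0) = 0` and `y(1) - i y'(1)/κ = 0` (meant for `κ ≠ 0`). -/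
def IsSolution (κ : ℂ) (B : ℝ → ℝ) (y : ℝ → ℂ) : Prop :=
  ∃ p q : ℝ → ℂ, IsW2InfWith y p q ∧
    (∀ᵐ x ∂(volume.restrict (Ioo (0 : ℝ) 1)), q x + κ ^ 2 * (B x : ℂ) * y x = 0) ∧
    p 0 = 0 ∧
    y 1 - Complex.I * p 1 / κ = 0

/-- The set `K(B)` of quasi-eigenvalues of the structure `B`. -/
def quasiEigenvalues (B : ℝ → ℝ) : Set ℂ :=
  {κ | κ ≠ 0 ∧ ∃ y : ℝ → ℂ, IsSolution κ B y ∧ ∃ x ∈ Icc (0 : ℝ) 1, y x ≠ 0}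

/-- The family of admissible structures: measurable functions `B` on `(0,1)` with
`b₁ ≤ B ≤ b₂` almost everywhere. -/
def admissible (b₁ b₂ : ℝ) : Set (ℝ → ℝ) :=
  {B | AEStronglyMeasurable B (volume.restrict (Ioo 0 1)) ∧
    ∀ᵐ x ∂(volume.restrict (Ioo (0 : ℝ) 1)), b₁ ≤ B x ∧ B x ≤ b₂}

/-- `κ` is an optimal quasi-eigenvalue for the frequency `α`: `κ = α + i I(α)`, where `I(α)` is
the minimum of `Im κ'` over all quasi-eigenvalues `κ'` of admissible structures
with `Re κ' = α`. -/
def IsOptimalQuasiEigenvalue (b₁ b₂ α : ℝ) (κ : ℂ) : Prop :=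
  κ.re = α ∧
    IsLeast {β : ℝ | ∃ B ∈ admissible b₁ b₂, ∃ κ' ∈ quasiEigenvalues B, κ'.re = α ∧ κ'.im = β}
      κ.im

/-- `B` is an optimal structure for the frequency `α`: it is admissible, and the optimal
quasi-eigenvalue `α + i I(α)` is one of its quasi-eigenvalues. -/
def IsOptimalStructure (b₁ b₂ α : ℝ) (B : ℝ → ℝ) : Prop :=
  B ∈ admissible b₁ b₂ ∧ ∃ κ ∈ quasiEigenvalues B, IsOptimalQuasiEigenvalue b₁ b₂ α κ

/-- The indicator function of the open upper half-plane. -/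
noncomputable def chiUpper (z : ℂ) : ℝ := {w : ℂ | 0 < w.im}.indicator 1 z

/-- The structure `b₁ + (b₂ - b₁) χ(y²)`, `χ` being the indicator function of the open upper
half-plane. -/
noncomputable def nonlinearStructure (b₁ b₂ : ℝ) (y : ℝ → ℂ) (x : ℝ) : ℝ :=
  b₁ + (b₂ - b₁) * chiUpper (y x ^ 2)

end QuasiNormal

/-! Let `y` be an eigenfunction of an optimal structure `B`, normalized by `y(0) = 1`. Replacing `B`
by `B + τ (B' - B)` changes the characteristic function to first order by a fixed nonzero multiple
of `κ² τ ∫ (B' - B) y²`. These variations form a convex cone in the plane. If the cone were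
everything, structures could be combined so as to move `κ` straight down
(`exists_lower_quasiEigenvalue`), against optimality. So the cone lies in a half-plane
(`span_or_halfPlane`): `Im (ν² ∫ (B' - B) y²) ≤ 0` for all `B'` and some `ν ≠ 0`. Thus `B` maximizes
`∫ B' Im (ν y)²`, which forces `B = b₁ + (b₂ - b₁) χ((ν y)²)` wherever `Im (ν y)² ≠ 0`
(`eq_of_halfPlane`), and `ν y` is the required solution.

The set `Im (ν y)² = 0` remains. By the energy identity, `Im (y' ȳ)` at `x` equals `-Im κ² ∫₀ˣ B
|y|²`. Where it is nonzero the argument of `y` moves, and such zeros are countable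
(`countable_zeros`). Where it is zero, `B = 0` almost everywhere (`ae_eq_zero_of_argument_const`),
so `b₁ = 0` and the formula holds there too. This needs `Im κ² ≠ 0`, which follows from `α ≠ 0`.

For `α = 0` the argument of `y` is constant and a comparison replaces the variation: against `cosh`,
the Wronskian shows that the constant structure `b₂` has a quasi-eigenvalue on the imaginary axis no
higher than `κ`. It is therefore optimal, and a rotation of `cosh` solves the nonlinear equation. -/

namespace QuasiNormal

open Filter Topology ComplexConjugate

/-! ### Bounded functions, their primitives and integration by parts. -/

/-- Measurable functions that are bounded on `[0,1]`. -/
structure BddMeasurable (g : ℝ → ℂ) : Prop where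
  meas : Measurable g
  bdd : ∃ C, ∀ x ∈ Icc (0 : ℝ) 1, ‖g x‖ ≤ C

namespace BddMeasurable

variable {f g : ℝ → ℂ}

lemma of_continuous (hg : Continuous g) : BddMeasurable g :=
  ⟨hg.measurable, isCompact_Icc.exists_bound_of_continuousOn hg.continuousOn⟩

lemma add (hf : BddMeasurable f) (hg : BddMeasurable g) :
    BddMeasurable fun x ↦ f x + g x := by
  obtain ⟨C, hC⟩ := hf.bdd
  obtain ⟨D, hD⟩ := hg.bdd
  exact ⟨hf.meas.add hg.meas, C + D,
    fun x hx ↦ (norm_add_le _ _).trans (add_le_add (hC x hx) (hD x hx))⟩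

lemma mul (hf : BddMeasurable f) (hg : BddMeasurable g) :
    BddMeasurable fun x ↦ f x * g x := by
  obtain ⟨C, hC⟩ := hf.bdd
  obtain ⟨D, hD⟩ := hg.bdd
  refine ⟨hf.meas.mul hg.meas, C * D, fun x hx ↦ ?_⟩
  rw [norm_mul]
  exact mul_le_mul (hC x hx) (hD x hx) (norm_nonneg _) ((norm_nonneg _).trans (hC x hx))

lemma const_mul (c : ℂ) (hf : BddMeasurable f) : BddMeasurable fun x ↦ c * f x :=
  (of_continuous continuous_const).mul hf

lemma mul_continuous (hf : BddMeasurable f) (hg : Continuous g) :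
    BddMeasurable fun x ↦ f x * g x := hf.mul (of_continuous hg)

lemma neg (hf : BddMeasurable f) : BddMeasurable fun x ↦ -f x := by
  simpa using hf.const_mul (-1)

lemma sub (hf : BddMeasurable f) (hg : BddMeasurable g) :
    BddMeasurable fun x ↦ f x - g x := by
  simpa [sub_eq_add_neg] using hf.add hg.neg

lemma integrableOn (hg : BddMeasurable g) : IntegrableOn g (Icc 0 1) := by
  obtain ⟨C, hC⟩ := hg.bdd
  refine Measure.integrableOn_of_bounded (M := C) (by simp) hg.meas.aestronglyMeasurable ?_
  exact (ae_restrict_iff' measurableSet_Icc).2 (Eventually.of_forall hC)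

lemma intervalIntegrable (hg : BddMeasurable g) {a b : ℝ} (ha : a ∈ Icc (0 : ℝ) 1)
    (hb : b ∈ Icc (0 : ℝ) 1) : IntervalIntegrable g volume a b :=
  ((hg.integrableOn.mono_set (uIcc_subset_Icc ha hb))).intervalIntegrable

lemma lipschitzOnWith_integral (hg : BddMeasurable g) :
    ∃ K, LipschitzOnWith K (fun x ↦ ∫ t in (0 : ℝ)..x, g t) (Icc 0 1) := by
  obtain ⟨C, hC⟩ := hg.bdd
  have h0 : (0 : ℝ) ∈ Icc (0 : ℝ) 1 := by simp
  refine ⟨C.toNNReal, LipschitzOnWith.of_dist_le_mul fun x hx y hy ↦ ?_⟩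
  rw [dist_eq_norm, intervalIntegral.integral_interval_sub_left (hg.intervalIntegrable h0 hx)
    (hg.intervalIntegrable h0 hy), Real.dist_eq]
  refine intervalIntegral.norm_integral_le_of_norm_le_const fun t ht ↦ ?_
  exact (hC t (uIcc_subset_Icc hy hx (uIoc_subset_uIcc ht))).trans (Real.le_coe_toNNReal C)

lemma continuousOn_integral (hg : BddMeasurable g) :
    ContinuousOn (fun x ↦ ∫ t in (0 : ℝ)..x, g t) (Icc 0 1) :=
  hg.lipschitzOnWith_integral.choose_spec.continuousOn

end BddMeasurable

/-- Integration by parts for a Lipschitz function, given as a primitive of `g`,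
and a continuously differentiable one. -/
lemma integral_by_parts {f g w w' : ℝ → ℂ} (hg : BddMeasurable g)
    (hf : ∀ t ∈ Icc (0 : ℝ) 1, f t = f 0 + ∫ s in (0 : ℝ)..t, g s)
    (hw : ∀ t, HasDerivAt w (w' t) t) (hw' : Continuous w') {x : ℝ} (hx : x ∈ Icc (0 : ℝ) 1) :
    ∫ t in (0 : ℝ)..x, (g t * w t + f t * w' t) = f x * w x - f 0 * w 0 := by
  have h0 : (0 : ℝ) ∈ Icc (0 : ℝ) 1 := by simp
  have hwc : Continuous w := continuous_iff_continuousAt.2 fun t ↦ (hw t).continuousAt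
  set F : ℝ → ℂ := fun t ↦ f 0 + ∫ s in (0 : ℝ)..t, g s with hF
  obtain ⟨K, hK⟩ := hg.lipschitzOnWith_integral
  have hFc : ContinuousOn F (Icc 0 1) := continuousOn_const.add hg.continuousOn_integral
  -- `f` is controlled only on `[0,1]`; a continuous extension makes the integrand measurable on the
  -- line.
  set G : ℝ → ℂ := fun t ↦ g t * w t + IccExtend zero_le_one ((Icc (0 : ℝ) 1).domRestrict F) t *
    w' t with hG
  have hext : Continuous (IccExtend zero_le_one ((Icc (0 : ℝ) 1).domRestrict F)) :=
    (continuousOn_iff_continuous_domRestrict.1 hFc).Icc_extend'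
  have hGb : BddMeasurable G :=
    (hg.mul_continuous hwc).add ((BddMeasurable.of_continuous hext).mul_continuous hw')
  obtain ⟨L, hL⟩ := hGb.lipschitzOnWith_integral
  have hu : uIcc (0 : ℝ) 1 = Icc 0 1 := uIcc_of_le zero_le_one
  have hwAC : AbsolutelyContinuousOnInterval w 0 1 := by
    refine ContDiffOn.absolutelyContinuousOnInterval (ContDiff.contDiffOn ?_)
    rw [contDiff_one_iff_deriv]
    refine ⟨fun t ↦ (hw t).differentiableAt, ?_⟩
    rwa [show deriv w = w' from funext fun t ↦ (hw t).deriv]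
  have hFAC : AbsolutelyContinuousOnInterval F 0 1 := by
    refine LipschitzOnWith.absolutelyContinuousOnInterval (K := K) ?_
    rw [hu]
    intro a ha b hb
    simpa [hF] using hK ha hb
  have hIAC : AbsolutelyContinuousOnInterval (fun x ↦ ∫ t in (0 : ℝ)..x, G t) 0 1 :=
    LipschitzOnWith.absolutelyContinuousOnInterval (K := L) (by rwa [hu])
  -- The product minus the primitive of its almost everywhere derivative is absolutely continuous
  -- with zero derivative almost everywhere, hence constant.
  have hAC := (hFAC.smul hwAC).sub hIAC
  obtain ⟨c, hc⟩ := hAC.const_of_ae_hasDerivAt_zero <| by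
    filter_upwards [(hg.intervalIntegrable h0 (b := 1) (by simp)).ae_hasDerivAt_integral,
      (hGb.intervalIntegrable h0 (b := 1) (by simp)).ae_hasDerivAt_integral] with t h1 h2 ht
    have h1' := ((h1 ht 0 (by simp)).const_add (f 0)).mul (hw t)
    have h3 := h1'.sub (h2 ht 0 (by simp))
    convert! h3 using 1
    simp [hG, hF, IccExtend_of_mem _ _ (hu ▸ ht)]
  have e1 := hc x (hu ▸ hx)
  have e0 := hc 0 (by simp)
  have e2 : ∫ t in (0 : ℝ)..x, (g t * w t + f t * w' t) = ∫ t in (0 : ℝ)..x, G t := by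
    refine intervalIntegral.integral_congr fun t ht ↦ ?_
    have ht' := uIcc_subset_Icc h0 hx ht
    simp [hG, IccExtend_of_mem _ _ ht', hf t ht', hF]
  rw [e2]
  simp only [Pi.sub_apply, smul_eq_mul, intervalIntegral.integral_same, sub_zero]
    at e1 e0
  have e3 : F x = f x := (hf x hx).symm
  have e4 : F 0 = f 0 := by simp [hF]
  change F x * w x - _ = c at e1
  change F 0 * w 0 = c at e0
  rw [e3] at e1
  rw [e4] at e0
  rw [e0, ← e1]
  ring

/-! ### Weak derivatives versus primitives. -/

lemma setIntegral_Ioo_eq (f : ℝ → ℂ) :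
    ∫ x in Ioo (0 : ℝ) 1, f x = ∫ x in (0 : ℝ)..1, f x := by
  rw [intervalIntegral.integral_of_le zero_le_one, integral_Ioc_eq_integral_Ioo]

lemma hasWeakDeriv_of_eq_integral {f g : ℝ → ℂ} (hg : BddMeasurable g)
    (hf : ∀ t ∈ Icc (0 : ℝ) 1, f t = f 0 + ∫ s in (0 : ℝ)..t, g s) : HasWeakDeriv f g := by
  intro φ hφ hc hs
  have h0 : φ 0 = 0 := image_eq_zero_of_notMem_tsupport fun h ↦ by simpa using hs h
  have h1 : φ 1 = 0 := image_eq_zero_of_notMem_tsupport fun h ↦ by simpa using hs h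
  have hφ' : Continuous fun t ↦ ((deriv φ t : ℝ) : ℂ) :=
    Complex.continuous_ofReal.comp (hφ.continuous_deriv (by simp))
  have hφc : Continuous fun t ↦ (φ t : ℂ) := Complex.continuous_ofReal.comp hφ.continuous
  have h := integral_by_parts hg hf (w := fun t ↦ (φ t : ℂ))
    (fun t ↦ ((hφ.differentiable (by simp)) t).hasDerivAt.ofReal_comp) hφ' (x := 1) (by simp)
  have m0 : (0 : ℝ) ∈ Icc (0 : ℝ) 1 := by simp
  have m1 : (1 : ℝ) ∈ Icc (0 : ℝ) 1 := by simp
  have hfc : ContinuousOn f (Icc 0 1) :=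
    (continuousOn_const.add hg.continuousOn_integral).congr hf
  rw [intervalIntegral.integral_add ((hg.mul_continuous hφc).intervalIntegrable m0 m1)] at h
  · rw [setIntegral_Ioo_eq, setIntegral_Ioo_eq, eq_neg_iff_add_eq_zero, add_comm]
    simpa [h0, h1, mul_comm] using h
  · refine ContinuousOn.intervalIntegrable ?_
    rw [uIcc_of_le zero_le_one]
    exact hfc.mul hφ'.continuousOn

/-- The du Bois-Reymond lemma. Subtracting `(∫ η) ρ` from a test function `η`, with `∫ ρ = 1`,
leaves mean zero, so the difference is the derivative of a test function. Hence `w - c` is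
orthogonal to every `η`, where `c = ∫ ρ w`. -/
lemma eq_const_of_integral_deriv_mul_eq_zero {w : ℝ → ℂ} (hw : ContinuousOn w (Icc 0 1))
    (h : ∀ φ : ℝ → ℝ, ContDiff ℝ ∞ φ → HasCompactSupport φ → tsupport φ ⊆ Ioo 0 1 →
      ∫ x in Ioo (0 : ℝ) 1, ((deriv φ x : ℝ) : ℂ) * w x = 0) :
    ∀ x ∈ Icc (0 : ℝ) 1, w x = w 0 := by
  let b : ContDiffBump (1 / 2 : ℝ) := ⟨1 / 8, 1 / 4, by norm_num, by norm_num⟩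
  set ρ : ℝ → ℝ := b.normed volume with hρ
  have hρs : tsupport ρ ⊆ Ioo 0 1 := by
    rw [hρ, b.tsupport_normed_eq]
    intro x hx
    rw [Real.closedBall_eq_Icc] at hx
    simp only [b] at hx
    constructor <;> linarith [hx.1, hx.2]
  have hρd : ContDiff ℝ ∞ ρ := b.contDiff_normed
  have hρi : ∫ x, ρ x = 1 := b.integral_normed
  have hρc : HasCompactSupport ρ := b.hasCompactSupport_normed
  set c : ℂ := ∫ x in Ioo (0 : ℝ) 1, (ρ x : ℂ) * w x with hcdef
  have hIoo : IntegrableOn w (Ioo 0 1) := (hw.integrableOn_Icc).mono_set Ioo_subset_Icc_self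
  have hint : ∀ η : ℝ → ℝ, Continuous η →
      IntegrableOn (fun x ↦ (η x : ℂ) * w x) (Ioo 0 1) := fun η hη ↦
    (((Complex.continuous_ofReal.comp hη).continuousOn.mul hw).integrableOn_Icc).mono_set
      Ioo_subset_Icc_self
  have key : ∀ η : ℝ → ℝ, ContDiff ℝ ∞ η → HasCompactSupport η → tsupport η ⊆ Ioo 0 1 →
      ∫ x, η x • (w x - c) = 0 := by
    intro η hη hηc hηs
    set m : ℝ := ∫ x, η x with hm
    set ζ : ℝ → ℝ := fun x ↦ η x - m * ρ x with hζ
    have hζd : ContDiff ℝ ∞ ζ := hη.sub (contDiff_const.mul hρd)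
    have hζc : HasCompactSupport ζ := hηc.sub hρc.mul_left
    have hζs : tsupport ζ ⊆ Ioo 0 1 :=
      (tsupport_sub η fun x ↦ m * ρ x).trans (union_subset hηs
        ((tsupport_mul_subset_right (f := fun _ ↦ m) (g := ρ)).trans hρs))
    have hηi : Integrable η := hη.continuous.integrable_of_hasCompactSupport hηc
    have hρint : Integrable ρ := hρd.continuous.integrable_of_hasCompactSupport hρc
    have hζi : Integrable ζ := hηi.sub (hρint.const_mul m)
    have hζ0 : ∫ x, ζ x = 0 := by
      rw [hζ, integral_sub hηi (hρint.const_mul m), integral_const_mul, hρi, mul_one, sub_self]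
    obtain ⟨a, a', ha, ha', haa⟩ : ∃ a a', 0 < a ∧ a' < 1 ∧ tsupport ζ ⊆ Icc a a' := by
      rcases (tsupport ζ).eq_empty_or_nonempty with he | hne
      · exact ⟨1 / 2, 1 / 2, by norm_num, by norm_num, by simp [he]⟩
      · exact ⟨sInf (tsupport ζ), sSup (tsupport ζ), (hζs (hζc.isCompact.sInf_mem hne)).1,
          (hζs (hζc.isCompact.sSup_mem hne)).2, subset_Icc_csInf_csSup hζc.isCompact.bddBelow
            hζc.isCompact.bddAbove⟩
    have hζz : ∀ x ∉ Icc a a', ζ x = 0 := fun x hx ↦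
      image_eq_zero_of_notMem_tsupport fun h ↦ hx (haa h)
    set φ : ℝ → ℝ := fun x ↦ ∫ t in (0 : ℝ)..x, ζ t with hφ
    have hφ' : ∀ x, HasDerivAt φ (ζ x) x := fun x ↦
      (hζd.continuous.integral_hasStrictDerivAt 0 x).hasDerivAt
    have hφ'' : deriv φ = ζ := funext fun x ↦ (hφ' x).deriv
    have hφd : ContDiff ℝ ∞ φ := by
      rw [contDiff_infty_iff_deriv, hφ'']
      exact ⟨fun x ↦ (hφ' x).differentiableAt, hζd⟩
    have hφz : ∀ x ∉ Icc a a', φ x = 0 := by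
      intro x hx
      rcases lt_or_ge x a with hxa | hxa
      · refine intervalIntegral.integral_zero_ae (Eventually.of_forall fun t ht ↦ hζz t ?_)
        rintro ⟨h1, h2⟩
        have := ht.2
        simp only [le_sup_iff] at this
        rcases this with h | h <;> linarith
      · have hxa' : a' < x := by
          by_contra hcon
          exact hx ⟨hxa, not_lt.1 hcon⟩
        -- Mean zero is what gives the primitive compact support: to the right of the support of `ζ`
        -- it equals the full integral.
        have hsplit : ∫ t in (0 : ℝ)..x, ζ t = ∫ t, ζ t := by
          refine intervalIntegral.integral_eq_integral_of_support_subset ?_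
          intro t ht
          have : t ∈ Icc a a' := by
            by_contra hcon
            exact ht (hζz t hcon)
          exact ⟨ha.trans_le this.1, this.2.trans hxa'.le⟩
        rw [hφ]
        simp only
        rw [hsplit, hζ0]
    have hφs : tsupport φ ⊆ Icc a a' := closure_minimal
      (fun x hx ↦ by by_contra hcon; exact hx (hφz x hcon)) isClosed_Icc
    have hh := h φ hφd (isCompact_Icc.of_isClosed_subset (isClosed_tsupport φ) hφs)
      (hφs.trans fun x hx ↦ ⟨ha.trans_le hx.1, hx.2.trans_lt ha'⟩)
    rw [hφ''] at hh
    have e1 : ∫ x in Ioo (0 : ℝ) 1, (ζ x : ℂ) * w x =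
        (∫ x in Ioo (0 : ℝ) 1, (η x : ℂ) * w x) - m * c := by
      rw [hcdef, ← integral_const_mul, ← integral_sub (hint η hη.continuous)
        ((hint ρ hρd.continuous).const_mul _)]
      refine integral_congr_ae (Eventually.of_forall fun x ↦ ?_)
      simp only [hζ]
      push_cast
      ring
    have e2 : ∫ x, η x • (w x - c) = ∫ x in Ioo (0 : ℝ) 1, η x • (w x - c) := by
      refine (setIntegral_eq_integral_of_forall_compl_eq_zero fun x hx ↦ ?_).symm
      rw [image_eq_zero_of_notMem_tsupport fun h ↦ hx (hηs h), zero_smul]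
    have e3 : (m : ℂ) = ∫ x in Ioo (0 : ℝ) 1, (η x : ℂ) := by
      rw [setIntegral_eq_integral_of_forall_compl_eq_zero, hm]
      · exact integral_ofReal.symm
      · intro x hx
        rw [image_eq_zero_of_notMem_tsupport fun h ↦ hx (hηs h), Complex.ofReal_zero]
    rw [e2, ← hh, e1, e3, ← integral_mul_const, ← integral_sub (hint η hη.continuous)]
    · refine integral_congr_ae (Eventually.of_forall fun x ↦ ?_)
      simp only [Complex.real_smul]
      ring
    · exact (hηi.ofReal.mul_const c).integrableOn
  have hae := isOpen_Ioo.ae_eq_zero_of_integral_contDiff_smul_eq_zero (μ := volume)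
    (((hIoo.sub (integrableOn_const (by simp)))).locallyIntegrableOn) key
  have hEq : EqOn w (fun _ ↦ c) (Icc 0 1) := by
    have h1 : EqOn w (fun _ ↦ c) (Ioo 0 1) := by
      refine Measure.eqOn_open_of_ae_eq (μ := volume) ?_ isOpen_Ioo
        (hw.mono Ioo_subset_Icc_self) continuousOn_const
      refine (ae_restrict_iff' measurableSet_Ioo).2 (hae.mono fun x hx hx' ↦ ?_)
      exact sub_eq_zero.1 (hx hx')
    refine h1.of_subset_closure hw continuousOn_const Ioo_subset_Icc_self ?_
    rw [closure_Ioo zero_ne_one]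
  intro x hx
  rw [hEq hx, hEq (by simp : (0 : ℝ) ∈ Icc (0 : ℝ) 1)]

/-- The primitive of `g` has the same weak derivative as `u`, so the two differ by a constant;
continuity of `u` makes this hold at every point. -/
lemma HasWeakDeriv.eq_add_integral {u g : ℝ → ℂ} (h : HasWeakDeriv u g)
    (hu : ContinuousOn u (Icc 0 1)) (hg : BddMeasurable g) :
    ∀ x ∈ Icc (0 : ℝ) 1, u x = u 0 + ∫ s in (0 : ℝ)..x, g s := by
  set G : ℝ → ℂ := fun x ↦ ∫ s in (0 : ℝ)..x, g s with hG
  have hGc : ContinuousOn G (Icc 0 1) := hg.continuousOn_integral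
  have hGw : HasWeakDeriv G g := hasWeakDeriv_of_eq_integral hg fun t _ ↦ by simp [hG]
  have key := eq_const_of_integral_deriv_mul_eq_zero (hu.sub hGc) fun φ hφ hc hs ↦ by
    have hφ' : Continuous fun t ↦ ((deriv φ t : ℝ) : ℂ) :=
      Complex.continuous_ofReal.comp (hφ.continuous_deriv (by simp))
    have hi : ∀ v : ℝ → ℂ, ContinuousOn v (Icc 0 1) →
        IntegrableOn (fun x ↦ ((deriv φ x : ℝ) : ℂ) * v x) (Ioo 0 1) := fun v hv ↦
      ((hφ'.continuousOn.mul hv).integrableOn_Icc).mono_set Ioo_subset_Icc_self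
    simp only [Pi.sub_apply, mul_sub]
    rw [integral_sub (hi u hu) (hi G hGc), h φ hφ hc hs, hGw φ hφ hc hs, sub_self]
  intro x hx
  have := key x hx
  simp only [Pi.sub_apply, hG, intervalIntegral.integral_same, sub_zero] at this
  rw [← this]
  ring

/-! ### The equation as an integrated first order system. -/

/-- The first order system `y' = p`, `p' = -c B y` on `[0,1]`, the second equation being
understood in the integrated form. -/
structure IsODESol (c : ℂ) (B : ℝ → ℂ) (y p : ℝ → ℂ) : Prop where
  hasDerivAt : ∀ x, HasDerivAt y (p x) x
  continuous_deriv : Continuous p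
  deriv_eq : ∀ x ∈ Icc (0 : ℝ) 1, p x = p 0 + ∫ s in (0 : ℝ)..x, -c * B s * y s

lemma IccExtend_eqOn {f : ℝ → ℂ} {x : ℝ} (hx : x ∈ Icc (0 : ℝ) 1) :
    IccExtend zero_le_one ((Icc (0 : ℝ) 1).domRestrict f) x = f x := by
  rw [IccExtend_of_mem _ _ hx, Set.domRestrict_apply]

lemma continuous_IccExtend {f : ℝ → ℂ} (hf : ContinuousOn f (Icc 0 1)) :
    Continuous (IccExtend zero_le_one ((Icc (0 : ℝ) 1).domRestrict f)) :=
  (continuousOn_iff_continuous_domRestrict.1 hf).Icc_extend'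

namespace IsODESol

variable {c : ℂ} {B y p : ℝ → ℂ}

lemma continuous (h : IsODESol c B y p) : Continuous y :=
  continuous_iff_continuousAt.2 fun t ↦ (h.hasDerivAt t).continuousAt

lemma bddMeasurable (h : IsODESol c B y p) (hB : BddMeasurable B) :
    BddMeasurable fun s ↦ -c * B s * y s := (hB.const_mul (-c)).mul_continuous h.continuous

lemma eq_integral (h : IsODESol c B y p) (x : ℝ) : y x = y 0 + ∫ s in (0 : ℝ)..x, p s := by
  rw [intervalIntegral.integral_eq_sub_of_hasDerivAt (fun t _ ↦ h.hasDerivAt t)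
    (h.continuous_deriv.intervalIntegrable _ _)]
  ring

/-- Integration by parts against a continuously differentiable function. -/
lemma integral_mul (h : IsODESol c B y p) (hB : BddMeasurable B) {w w' : ℝ → ℂ}
    (hw : ∀ t, HasDerivAt w (w' t) t) (hw' : Continuous w') {x : ℝ} (hx : x ∈ Icc (0 : ℝ) 1) :
    ∫ t in (0 : ℝ)..x, (-c * B t * y t * w t + p t * w' t) = p x * w x - p 0 * w 0 :=
  integral_by_parts (h.bddMeasurable hB) h.deriv_eq hw hw' hx

/-- From functions satisfying the integrated system on `[0,1]` to a solution on the line. -/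
lemma exists_of_eqOn (hp : ContinuousOn p (Icc 0 1))
    (hyp : ∀ x ∈ Icc (0 : ℝ) 1, y x = y 0 + ∫ s in (0 : ℝ)..x, p s)
    (hpy : ∀ x ∈ Icc (0 : ℝ) 1, p x = p 0 + ∫ s in (0 : ℝ)..x, -c * B s * y s) :
    ∃ y' p', IsODESol c B y' p' ∧ EqOn y' y (Icc 0 1) ∧ EqOn p' p (Icc 0 1) := by
  have h0 : (0 : ℝ) ∈ Icc (0 : ℝ) 1 := by simp
  have hc := continuous_IccExtend hp
  set P := IccExtend zero_le_one ((Icc (0 : ℝ) 1).domRestrict p) with hP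
  have hPp : EqOn P p (Icc 0 1) := fun x hx ↦ IccExtend_eqOn hx
  set Y : ℝ → ℂ := fun x ↦ y 0 + ∫ s in (0 : ℝ)..x, P s with hY
  have hYy : EqOn Y y (Icc 0 1) := fun x hx ↦ by
    rw [hyp x hx, hY]
    simp only
    congr 1
    exact intervalIntegral.integral_congr fun t ht ↦ hPp (uIcc_subset_Icc h0 hx ht)
  refine ⟨Y, P, ⟨fun x ↦ ?_, hc, fun x hx ↦ ?_⟩, hYy, hPp⟩
  · exact (hc.integral_hasStrictDerivAt 0 x).hasDerivAt.const_add _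
  · rw [hPp hx, hPp h0, hpy x hx]
    congr 1
    exact intervalIntegral.integral_congr fun t ht ↦ by
      simp only [hYy (uIcc_subset_Icc h0 hx ht)]

lemma const_mul (h : IsODESol c B y p) (a : ℂ) :
    IsODESol c B (fun x ↦ a * y x) (fun x ↦ a * p x) where
  hasDerivAt x := (h.hasDerivAt x).const_mul a
  continuous_deriv := continuous_const.mul h.continuous_deriv
  deriv_eq x hx := by
    rw [h.deriv_eq x hx, mul_add, ← intervalIntegral.integral_const_mul]
    congr 2
    ext t
    ring

end IsODESol

/-- Passes from the weak formulation to the system: `q` is eliminated by means of the equation, `B`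
is traded for a bounded representative, and the condition at `1` is cleared of its denominator. -/
lemma IsSolution.exists_isODESol {κ : ℂ} {B B₀ : ℝ → ℝ} {y : ℝ → ℂ} (h : IsSolution κ B y)
    (hκ : κ ≠ 0) (hB₀ : BddMeasurable fun x ↦ (B₀ x : ℂ))
    (hBB : B =ᵐ[volume.restrict (Ioo 0 1)] B₀) :
    ∃ y' p', IsODESol (κ ^ 2) (fun x ↦ (B₀ x : ℂ)) y' p' ∧ EqOn y' y (Icc 0 1) ∧ p' 0 = 0 ∧
      p' 1 = -Complex.I * κ * y' 1 := by
  obtain ⟨p, q, hW, hq, hp0, hp1⟩ := h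
  have hyc := continuous_IccExtend hW.continuousOn
  have hpc := continuous_IccExtend hW.continuousOn_deriv
  set Y := IccExtend zero_le_one ((Icc (0 : ℝ) 1).domRestrict y) with hY
  set P := IccExtend zero_le_one ((Icc (0 : ℝ) 1).domRestrict p) with hP
  have hYy : EqOn Y y (Icc 0 1) := fun x hx ↦ IccExtend_eqOn hx
  have hPp : EqOn P p (Icc 0 1) := fun x hx ↦ IccExtend_eqOn hx
  have h0 : (0 : ℝ) ∈ Icc (0 : ℝ) 1 := by simp
  have h1 : (1 : ℝ) ∈ Icc (0 : ℝ) 1 := by simp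
  have hg : BddMeasurable fun s ↦ -κ ^ 2 * (B₀ s : ℂ) * Y s :=
    (hB₀.const_mul (-κ ^ 2)).mul_continuous hyc
  have hw1 : HasWeakDeriv y P := fun φ h1 h2 h3 ↦ by
    rw [hW.weakDeriv φ h1 h2 h3]
    congr 1
    refine setIntegral_congr_fun measurableSet_Ioo fun x hx ↦ ?_
    simp only [hPp (Ioo_subset_Icc_self hx)]
  have hw2 : HasWeakDeriv p fun s ↦ -κ ^ 2 * (B₀ s : ℂ) * Y s := fun φ h1 h2 h3 ↦ by
    rw [hW.weakDeriv2 φ h1 h2 h3]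
    congr 1
    refine integral_congr_ae ?_
    filter_upwards [hq, hBB, ae_restrict_mem measurableSet_Ioo] with x hx1 hx2 hx3
    rw [hYy (Ioo_subset_Icc_self hx3), ← hx2, eq_neg_of_add_eq_zero_left hx1]
    ring
  have e1 := hw1.eq_add_integral hW.continuousOn (BddMeasurable.of_continuous hpc)
  have e2 := hw2.eq_add_integral hW.continuousOn_deriv hg
  obtain ⟨y', p', hs, hy', hp'⟩ := IsODESol.exists_of_eqOn (c := κ ^ 2)
    (B := fun x ↦ (B₀ x : ℂ)) (y := y) (p := p)
    hW.continuousOn_deriv (fun x hx ↦ by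
      rw [e1 x hx]
      congr 1
      exact intervalIntegral.integral_congr fun t ht ↦ hPp (uIcc_subset_Icc h0 hx ht))
    (fun x hx ↦ by
      rw [e2 x hx]
      congr 1
      exact intervalIntegral.integral_congr fun t ht ↦ by
        simp only [hYy (uIcc_subset_Icc h0 hx ht)])
  refine ⟨y', p', hs, hy', (hp' h0).trans hp0, ?_⟩
  rw [hp' h1, hy' h1, sub_eq_zero.1 hp1]
  field_simp
  rw [Complex.I_sq]
  ring

lemma IsODESol.isSolution {κ : ℂ} {B B₀ : ℝ → ℝ} {y p : ℝ → ℂ}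
    (h : IsODESol (κ ^ 2) (fun x ↦ (B₀ x : ℂ)) y p) (hκ : κ ≠ 0)
    (hB₀ : BddMeasurable fun x ↦ (B₀ x : ℂ)) (hBB : B =ᵐ[volume.restrict (Ioo 0 1)] B₀)
    (hp0 : p 0 = 0) (hp1 : p 1 = -Complex.I * κ * y 1) : IsSolution κ B y := by
  have hg := h.bddMeasurable hB₀
  refine ⟨p, fun s ↦ -κ ^ 2 * (B₀ s : ℂ) * y s, ⟨h.continuous.continuousOn,
    h.continuous_deriv.continuousOn, ?_,
    hasWeakDeriv_of_eq_integral (BddMeasurable.of_continuous h.continuous_deriv)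
      fun t _ ↦ h.eq_integral t, hasWeakDeriv_of_eq_integral hg h.deriv_eq⟩, ?_, hp0, ?_⟩
  · obtain ⟨C, hC⟩ := hg.bdd
    refine memLp_top_of_bound hg.meas.aestronglyMeasurable C ?_
    filter_upwards [ae_restrict_mem measurableSet_Ioo] with x hx
    exact hC x (Ioo_subset_Icc_self hx)
  · filter_upwards [hBB] with x hx
    rw [hx]
    ring
  · rw [hp1]
    field_simp
    rw [Complex.I_sq]
    ring

/-! ### Uniqueness, Wronskian and energy identities. -/

/-- A continuous function dominated by its primitive vanishes. -/
lemma eq_zero_of_norm_le_integral {y : ℝ → ℂ} (hy : Continuous y) {C : ℝ}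
    (h : ∀ x ∈ Icc (0 : ℝ) 1, ‖y x‖ ≤ C * ∫ s in (0 : ℝ)..x, ‖y s‖) :
    ∀ x ∈ Icc (0 : ℝ) 1, y x = 0 := by
  have hd : ∀ x, HasDerivAt (fun x ↦ ∫ s in (0 : ℝ)..x, ‖y s‖) ‖y x‖ x := fun x ↦
    (hy.norm.integral_hasStrictDerivAt 0 x).hasDerivAt
  have h0 := eq_zero_of_abs_deriv_le_mul_abs_self_of_eq_zero_right (K := C) (a := 0) (b := 1)
    (fun x _ ↦ (hd x).continuousAt.continuousWithinAt) (fun x _ ↦ (hd x).hasDerivWithinAt)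
    intervalIntegral.integral_same (fun x hx ↦ by
      have : 0 ≤ ∫ s in (0 : ℝ)..x, ‖y s‖ :=
        intervalIntegral.integral_nonneg hx.1 fun t _ ↦ norm_nonneg _
      rw [norm_norm, Real.norm_of_nonneg this]
      exact h x (Ico_subset_Icc_self hx))
  intro x hx
  have := h x hx
  rw [h0 x hx, mul_zero] at this
  exact norm_le_zero_iff.1 this

namespace IsODESol

variable {c : ℂ} {B y p : ℝ → ℂ}

/-- The Volterra integral equation satisfied by a solution. -/
lemma eq_volterra (h : IsODESol c B y p) (hB : BddMeasurable B) {x : ℝ}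
    (hx : x ∈ Icc (0 : ℝ) 1) :
    y x = y 0 + p 0 * x + ∫ s in (0 : ℝ)..x, ((x - s : ℝ) : ℂ) * (-c * B s * y s) := by
  have h0 : (0 : ℝ) ∈ Icc (0 : ℝ) 1 := by simp
  -- Integrating by parts against `x - t` collapses the double primitive to a single integral.
  have hw : ∀ t, HasDerivAt (fun t : ℝ ↦ ((x - t : ℝ) : ℂ)) (-1) t := fun t ↦ by
    simpa using ((hasDerivAt_id t).const_sub x).ofReal_comp
  have hwc : Continuous fun t : ℝ ↦ ((x - t : ℝ) : ℂ) := by fun_prop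
  have key := h.integral_mul hB hw continuous_const hx
  rw [intervalIntegral.integral_add
    (((h.bddMeasurable hB).mul_continuous hwc).intervalIntegrable h0 hx)
    (Continuous.intervalIntegrable (u := fun t ↦ p t * -1)
      (h.continuous_deriv.mul continuous_const) _ _)] at key
  simp only [mul_neg, mul_one, intervalIntegral.integral_neg, sub_self, Complex.ofReal_zero,
    mul_zero, sub_zero, zero_sub] at key
  rw [h.eq_integral x]
  simp only [mul_comm (((x - _ : ℝ) : ℂ))]
  linear_combination -key

/-- Since `x - s ≤ 1`, the Volterra equation bounds `‖y‖` by a multiple of the primitive of `‖y‖`,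
and Grönwall applies. -/
lemma eq_zero_of_initial (h : IsODESol c B y p) (hB : BddMeasurable B) (hy0 : y 0 = 0)
    (hp0 : p 0 = 0) : ∀ x ∈ Icc (0 : ℝ) 1, y x = 0 := by
  have h0 : (0 : ℝ) ∈ Icc (0 : ℝ) 1 := by simp
  obtain ⟨C, hC⟩ := (hB.const_mul (-c)).bdd
  refine eq_zero_of_norm_le_integral h.continuous (C := C) fun x hx ↦ ?_
  rw [h.eq_volterra hB hx, hy0, hp0, zero_mul, zero_add, zero_add,
    ← intervalIntegral.integral_const_mul]
  refine intervalIntegral.norm_integral_le_of_norm_le hx.1 (Eventually.of_forall fun t ht ↦ ?_)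
    ((continuous_const.mul h.continuous.norm).intervalIntegrable _ _)
  have ht1 : t ∈ Icc (0 : ℝ) 1 := ⟨ht.1.le, ht.2.trans hx.2⟩
  rw [norm_mul, norm_mul, Complex.norm_real, Real.norm_of_nonneg (by linarith [ht.2])]
  have h1 : x - t ≤ 1 := by linarith [ht.1, hx.2]
  have h2 := mul_le_mul_of_nonneg_right (hC t ht1) (norm_nonneg (y t))
  calc (x - t) * (‖-c * B t‖ * ‖y t‖) ≤ 1 * (‖-c * B t‖ * ‖y t‖) := by gcongr
    _ ≤ _ := by rwa [one_mul]

lemma reflect (h : IsODESol c B y p) (hB : BddMeasurable B) :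
    IsODESol c (fun x ↦ B (1 - x)) (fun x ↦ y (1 - x)) (fun x ↦ -p (1 - x)) where
  hasDerivAt x := (h.hasDerivAt (1 - x)).comp_const_sub 1 x
  continuous_deriv := by
    have := h.continuous_deriv
    fun_prop
  deriv_eq x hx := by
    have h0 : (0 : ℝ) ∈ Icc (0 : ℝ) 1 := by simp
    have h1 : (1 : ℝ) ∈ Icc (0 : ℝ) 1 := by simp
    have hx' : 1 - x ∈ Icc (0 : ℝ) 1 := ⟨by linarith [hx.2], by linarith [hx.1]⟩
    rw [intervalIntegral.integral_comp_sub_left (fun s ↦ -c * B s * y s), sub_zero,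
      h.deriv_eq _ h1, h.deriv_eq _ hx', ← intervalIntegral.integral_add_adjacent_intervals
      ((h.bddMeasurable hB).intervalIntegrable h0 hx')
      ((h.bddMeasurable hB).intervalIntegrable hx' h1)]
    ring

/-- Reflection in `1/2` reduces this to initial data. It serves to show `y 1 ≠ 0` for
eigenfunctions, as `y 1 = 0` forces `p 1 = 0` through the boundary condition. -/
lemma eq_zero_of_terminal (h : IsODESol c B y p) (hB : BddMeasurable B) (hy1 : y 1 = 0)
    (hp1 : p 1 = 0) : ∀ x ∈ Icc (0 : ℝ) 1, y x = 0 := by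
  have hBr : BddMeasurable fun x ↦ B (1 - x) := by
    obtain ⟨C, hC⟩ := hB.bdd
    exact ⟨hB.meas.comp (measurable_const.sub measurable_id), C,
      fun x hx ↦ hC _ ⟨by linarith [hx.2], by linarith [hx.1]⟩⟩
  intro x hx
  simpa using (h.reflect hB).eq_zero_of_initial hBr (by simpa using hy1) (by simpa using hp1)
    (1 - x) ⟨by linarith [hx.2], by linarith [hx.1]⟩

/-- The Wronskian identity. -/
lemma wronskian {c₁ c₂ : ℂ} {B₁ B₂ y₁ p₁ y₂ p₂ : ℝ → ℂ} (h₁ : IsODESol c₁ B₁ y₁ p₁)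
    (h₂ : IsODESol c₂ B₂ y₂ p₂) (hB₁ : BddMeasurable B₁) (hB₂ : BddMeasurable B₂) {x : ℝ}
    (hx : x ∈ Icc (0 : ℝ) 1) :
    ∫ t in (0 : ℝ)..x, (c₂ * B₂ t - c₁ * B₁ t) * (y₁ t * y₂ t) =
      (p₁ x * y₂ x - y₁ x * p₂ x) - (p₁ 0 * y₂ 0 - y₁ 0 * p₂ 0) := by
  have h0 : (0 : ℝ) ∈ Icc (0 : ℝ) 1 := by simp
  have e1 := h₁.integral_mul hB₁ h₂.hasDerivAt h₂.continuous_deriv hx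
  have e2 := h₂.integral_mul hB₂ h₁.hasDerivAt h₁.continuous_deriv hx
  have i1 := (((h₁.bddMeasurable hB₁).mul_continuous h₂.continuous).add
    (BddMeasurable.of_continuous
      (h₁.continuous_deriv.mul h₂.continuous_deriv))).intervalIntegrable h0 hx
  have i2 := (((h₂.bddMeasurable hB₂).mul_continuous h₁.continuous).add
    (BddMeasurable.of_continuous
      (h₂.continuous_deriv.mul h₁.continuous_deriv))).intervalIntegrable h0 hx
  have e3 := intervalIntegral.integral_sub i1 i2
  simp only [Pi.mul_apply] at e3
  rw [e1, e2] at e3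
  trans p₁ x * y₂ x - p₁ 0 * y₂ 0 - (p₂ x * y₁ x - p₂ 0 * y₁ 0)
  · rw [← e3]
    refine intervalIntegral.integral_congr fun t _ ↦ ?_
    ring
  · ring

/-- The energy identity. -/
lemma energy {B : ℝ → ℝ} (h : IsODESol c (fun x ↦ (B x : ℂ)) y p)
    (hB : BddMeasurable fun x ↦ (B x : ℂ)) (hp0 : p 0 = 0) {x : ℝ} (hx : x ∈ Icc (0 : ℝ) 1) :
    p x * conj (y x) = ((∫ t in (0 : ℝ)..x, Complex.normSq (p t) : ℝ) : ℂ) -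
      c * ((∫ t in (0 : ℝ)..x, B t * Complex.normSq (y t) : ℝ) : ℂ) := by
  have h0 : (0 : ℝ) ∈ Icc (0 : ℝ) 1 := by simp
  have hyc := h.continuous
  have hpc := h.continuous_deriv
  -- The equation is tested against the conjugate of the solution itself.
  have key := h.integral_mul hB (w := fun t ↦ conj (y t)) (w' := fun t ↦ conj (p t))
    (fun t ↦ (h.hasDerivAt t).star) (Complex.continuous_conj.comp h.continuous_deriv) hx
  rw [hp0, zero_mul, sub_zero] at key
  rw [← key, ← intervalIntegral.integral_ofReal, ← intervalIntegral.integral_ofReal,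
    ← intervalIntegral.integral_const_mul, ← intervalIntegral.integral_sub]
  · refine intervalIntegral.integral_congr fun t _ ↦ ?_
    simp only [Complex.ofReal_mul, ← Complex.mul_conj]
    ring
  · exact Continuous.intervalIntegrable (by fun_prop) _ _
  · have := (hB.mul_continuous (g := fun t ↦ ((Complex.normSq (y t) : ℝ) : ℂ))
      (by fun_prop)).const_mul c
    simpa using this.intervalIntegrable h0 hx

end IsODESol

/-! ### Existence and smooth dependence on parameters through weighted Volterra operators. -/

lemma BddMeasurable.sum {ι : Type*} [Fintype ι] {V : ι → ℝ → ℂ} (hV : ∀ j, BddMeasurable (V j))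
    (a : ι → ℂ) : BddMeasurable fun x ↦ ∑ j, a j * V j x := by
  classical
  have : ∀ s : Finset ι, BddMeasurable fun x ↦ ∑ j ∈ s, a j * V j x := by
    intro s
    induction s using Finset.induction_on with
    | empty => simpa using BddMeasurable.of_continuous (continuous_const (y := (0 : ℂ)))
    | insert j s hj ih =>
      simp only [Finset.sum_insert hj]
      exact ((hV j).const_mul (a j)).add ih
  exact this Finset.univ

/-- The extension of a continuous function on `[0,1]` to the line that is constant on both sides
of the interval. -/
noncomputable def extend (ψ : C(Icc (0 : ℝ) 1, ℂ)) : ℝ → ℂ := IccExtend zero_le_one ψ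

lemma continuous_extend (ψ : C(Icc (0 : ℝ) 1, ℂ)) : Continuous (extend ψ) :=
  ψ.continuous.Icc_extend'

lemma norm_extend_le (ψ : C(Icc (0 : ℝ) 1, ℂ)) (x : ℝ) : ‖extend ψ x‖ ≤ ‖ψ‖ :=
  ψ.norm_coe_le_norm _

lemma extend_add (ψ χ : C(Icc (0 : ℝ) 1, ℂ)) (x : ℝ) :
    extend (ψ + χ) x = extend ψ x + extend χ x := rfl

lemma extend_smul (c : ℂ) (ψ : C(Icc (0 : ℝ) 1, ℂ)) (x : ℝ) :
    extend (c • ψ) x = c * extend ψ x := rfl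

lemma extend_apply (ψ : C(Icc (0 : ℝ) 1, ℂ)) (x : Icc (0 : ℝ) 1) : extend ψ x = ψ x :=
  IccExtend_val _ _ _

/-- Integration over `[0,1]` against a bounded function, as a continuous linear functional. -/
noncomputable def integralCLM (g : ℝ → ℂ) (hg : BddMeasurable g) :
    C(Icc (0 : ℝ) 1, ℂ) →L[ℂ] ℂ :=
  LinearMap.mkContinuousOfExistsBound
    { toFun := fun ψ ↦ ∫ s in (0 : ℝ)..1, g s * extend ψ s
      map_add' := fun ψ χ ↦ by
        simp only [extend_add, mul_add]
        exact intervalIntegral.integral_add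
          ((hg.mul_continuous (continuous_extend ψ)).intervalIntegrable (by simp) (by simp))
          ((hg.mul_continuous (continuous_extend χ)).intervalIntegrable (by simp) (by simp))
      map_smul' := fun c ψ ↦ by
        simp only [extend_smul, RingHom.id_apply, smul_eq_mul]
        rw [← intervalIntegral.integral_const_mul]
        refine intervalIntegral.integral_congr fun t _ ↦ ?_
        ring } <| by
    obtain ⟨C, hC⟩ := hg.bdd
    refine ⟨C, fun ψ ↦ ?_⟩
    refine (intervalIntegral.norm_integral_le_of_norm_le_const (C := C * ‖ψ‖)
      fun t ht ↦ ?_).trans (by simp)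
    rw [uIoc_of_le zero_le_one] at ht
    have ht' : t ∈ Icc (0 : ℝ) 1 := Ioc_subset_Icc_self ht
    rw [norm_mul]
    exact mul_le_mul (hC t ht') (norm_extend_le ψ t) (norm_nonneg _)
      ((norm_nonneg _).trans (hC t ht'))

lemma integralCLM_apply (g : ℝ → ℂ) (hg : BddMeasurable g) (ψ : C(Icc (0 : ℝ) 1, ℂ)) :
    integralCLM g hg ψ = ∫ s in (0 : ℝ)..1, g s * extend ψ s := rfl

/-- The kernel of the weighted Volterra operator. -/
noncomputable def volterraKernel (l r : ℝ) : ℂ := ((r * Real.exp (-(l * r)) : ℝ) : ℂ)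

lemma continuous_volterraKernel (l x : ℝ) : Continuous fun s ↦ volterraKernel l (x - s) := by
  unfold volterraKernel
  fun_prop

/-- From `l r ≤ exp (l r)`. The gain `1 / l` is the purpose of the exponential weight: for large `l`
the operator is a contraction. -/
lemma norm_volterraKernel_le {l r : ℝ} (hl : 0 < l) (hr : 0 ≤ r) :
    ‖volterraKernel l r‖ ≤ 1 / l := by
  have h1 : l * r ≤ Real.exp (l * r) := (by linarith : l * r ≤ l * r + 1).trans
    (Real.add_one_le_exp _)
  rw [volterraKernel, Complex.norm_real, Real.norm_of_nonneg (by positivity), le_div_iff₀ hl,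
    Real.exp_neg, mul_right_comm, mul_inv_le_iff₀ (Real.exp_pos _)]
  linarith

/-- The value at `x` of the weighted Volterra operator with potential `V`. -/
noncomputable def volterraFun (l : ℝ) (V f : ℝ → ℂ) (x : ℝ) : ℂ :=
  ∫ s in (0 : ℝ)..x, volterraKernel l (x - s) * (V s * f s)

/-- The kernel splits into products of a function of `x` and a function of `s`, so the integral is a
combination of primitives with continuous coefficients. -/
lemma continuousOn_volterraFun (l : ℝ) {V f : ℝ → ℂ} (hV : BddMeasurable V) (hf : Continuous f) :
    ContinuousOn (volterraFun l V f) (Icc 0 1) := by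
  have h0 : (0 : ℝ) ∈ Icc (0 : ℝ) 1 := by simp
  have h1 : BddMeasurable fun s ↦ (Real.exp (l * s) : ℂ) * (V s * f s) :=
    (BddMeasurable.of_continuous (by fun_prop)).mul (hV.mul_continuous hf)
  have h2 : BddMeasurable fun s ↦ (s : ℂ) * ((Real.exp (l * s) : ℂ) * (V s * f s)) :=
    (BddMeasurable.of_continuous (by fun_prop)).mul h1
  have key : EqOn (volterraFun l V f) (fun x ↦ (Real.exp (-(l * x)) : ℂ) *
      (x * (∫ s in (0 : ℝ)..x, (Real.exp (l * s) : ℂ) * (V s * f s)) -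
        ∫ s in (0 : ℝ)..x, (s : ℂ) * ((Real.exp (l * s) : ℂ) * (V s * f s)))) (Icc 0 1) := by
    intro x hx
    simp only
    rw [← intervalIntegral.integral_const_mul, ← intervalIntegral.integral_sub
      ((h1.const_mul x).intervalIntegrable h0 hx) (h2.intervalIntegrable h0 hx),
      ← intervalIntegral.integral_const_mul]
    refine intervalIntegral.integral_congr fun s _ ↦ ?_
    have : Real.exp (-(l * (x - s))) = Real.exp (-(l * x)) * Real.exp (l * s) := by
      rw [← Real.exp_add]
      congr 1
      ring
    simp only [volterraKernel]
    rw [this]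
    push_cast
    ring
  refine ContinuousOn.congr ?_ key
  refine ContinuousOn.mul (by fun_prop) (ContinuousOn.sub (ContinuousOn.mul (by fun_prop) ?_) ?_)
  · exact h1.continuousOn_integral
  · exact h2.continuousOn_integral

lemma norm_volterraFun_le {l : ℝ} (hl : 0 < l) {V f : ℝ → ℂ} {C D : ℝ}
    (hC : ∀ x ∈ Icc (0 : ℝ) 1, ‖V x‖ ≤ C) (hD : ∀ x ∈ Icc (0 : ℝ) 1, ‖f x‖ ≤ D)
    {x : ℝ} (hx : x ∈ Icc (0 : ℝ) 1) : ‖volterraFun l V f x‖ ≤ 1 / l * (C * D) := by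
  have h0 : (0 : ℝ) ∈ Icc (0 : ℝ) 1 := by simp
  have hC0 : 0 ≤ C := (norm_nonneg _).trans (hC 0 h0)
  have hD0 : 0 ≤ D := (norm_nonneg _).trans (hD 0 h0)
  refine (intervalIntegral.norm_integral_le_of_norm_le_const (C := 1 / l * (C * D))
    fun t ht ↦ ?_).trans ?_
  · rw [uIoc_of_le hx.1] at ht
    have ht' : t ∈ Icc (0 : ℝ) 1 := ⟨ht.1.le, ht.2.trans hx.2⟩
    rw [norm_mul, norm_mul]
    exact mul_le_mul (norm_volterraKernel_le hl (by linarith [ht.2]))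
      (mul_le_mul (hC t ht') (hD t ht') (norm_nonneg _) hC0) (by positivity) (by positivity)
  · rw [sub_zero, abs_of_nonneg hx.1]
    exact mul_le_of_le_one_right (by positivity) hx.2

lemma volterraFun_intervalIntegrable (l : ℝ) {V f : ℝ → ℂ} (hV : BddMeasurable V)
    (hf : Continuous f) {x : ℝ} (hx : x ∈ Icc (0 : ℝ) 1) :
    IntervalIntegrable (fun s ↦ volterraKernel l (x - s) * (V s * f s)) volume 0 x :=
  ((BddMeasurable.of_continuous (continuous_volterraKernel l x)).mul
    (hV.mul_continuous hf)).intervalIntegrable (by simp) hx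

/-- The weighted Volterra operator with potential `V` on the space of continuous functions. -/
noncomputable def volterraCLM (l : ℝ) (hl : 0 < l) (V : ℝ → ℂ) (hV : BddMeasurable V) :
    C(Icc (0 : ℝ) 1, ℂ) →L[ℂ] C(Icc (0 : ℝ) 1, ℂ) :=
  LinearMap.mkContinuousOfExistsBound
    { toFun := fun ψ ↦ ⟨fun x ↦ volterraFun l V (extend ψ) x,
        continuousOn_iff_continuous_domRestrict.1
          (continuousOn_volterraFun l hV (continuous_extend ψ))⟩
      map_add' := fun ψ χ ↦ by
        ext x
        simp only [ContinuousMap.coe_mk, ContinuousMap.add_apply, volterraFun]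
        rw [← intervalIntegral.integral_add
          (volterraFun_intervalIntegrable l hV (continuous_extend ψ) x.2)
          (volterraFun_intervalIntegrable l hV (continuous_extend χ) x.2)]
        refine intervalIntegral.integral_congr fun t _ ↦ ?_
        simp only [extend_add]
        ring
      map_smul' := fun c ψ ↦ by
        ext x
        simp only [ContinuousMap.coe_mk, ContinuousMap.smul_apply, volterraFun, RingHom.id_apply,
          smul_eq_mul]
        rw [← intervalIntegral.integral_const_mul]
        refine intervalIntegral.integral_congr fun t _ ↦ ?_
        simp only [extend_smul]
        ring } <| by
    obtain ⟨C, hC⟩ := hV.bdd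
    have hC0 : 0 ≤ C := (norm_nonneg _).trans (hC 0 (by simp))
    refine ⟨1 / l * C, fun ψ ↦ (ContinuousMap.norm_le _ (by positivity)).2 fun x ↦ ?_⟩
    rw [mul_assoc]
    exact norm_volterraFun_le hl hC (fun t _ ↦ norm_extend_le ψ t) x.2

lemma volterraCLM_apply (l : ℝ) (hl : 0 < l) (V : ℝ → ℂ) (hV : BddMeasurable V)
    (ψ : C(Icc (0 : ℝ) 1, ℂ)) (x : Icc (0 : ℝ) 1) :
    volterraCLM l hl V hV ψ x = volterraFun l V (extend ψ) x := rfl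

lemma norm_volterraCLM_le {l : ℝ} (hl : 0 < l) {V : ℝ → ℂ} (hV : BddMeasurable V) {C : ℝ}
    (hC : ∀ x ∈ Icc (0 : ℝ) 1, ‖V x‖ ≤ C) : ‖volterraCLM l hl V hV‖ ≤ 1 / l * C := by
  have hC0 : 0 ≤ C := (norm_nonneg _).trans (hC 0 (by simp))
  refine ContinuousLinearMap.opNorm_le_bound _ (by positivity) fun ψ ↦ ?_
  refine (ContinuousMap.norm_le _ (by positivity)).2 fun x ↦ ?_
  rw [mul_assoc]
  exact norm_volterraFun_le hl hC (fun t _ ↦ norm_extend_le ψ t) x.2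

/-- Linearity in the potential: the operators stay fixed and the parameters enter only through
scalar coefficients. -/
lemma sum_volterraCLM {ι : Type*} [Fintype ι] {V : ι → ℝ → ℂ} (hV : ∀ j, BddMeasurable (V j))
    (a : ι → ℂ) (l : ℝ) (hl : 0 < l) :
    ∑ j, a j • volterraCLM l hl (V j) (hV j) =
      volterraCLM l hl (fun x ↦ ∑ j, a j * V j x) (BddMeasurable.sum hV a) := by
  ext ψ x
  rw [_root_.sum_apply, ContinuousMap.sum_apply, volterraCLM_apply]
  simp only [_root_.smul_apply, ContinuousMap.smul_apply, volterraCLM_apply,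
    smul_eq_mul, volterraFun]
  simp_rw [← intervalIntegral.integral_const_mul]
  rw [← intervalIntegral.integral_finsetSum]
  · refine intervalIntegral.integral_congr fun t _ ↦ ?_
    simp only [Finset.sum_mul, Finset.mul_sum]
    exact Finset.sum_congr rfl fun j _ ↦ by ring
  · intro j _
    exact (volterraFun_intervalIntegrable l (hV j) (continuous_extend ψ) x.2).const_mul _

/-- A fixed point equation for the weighted Volterra operator yields a solution of the system. -/
lemma exists_isODESol_of_volterra {l : ℝ} (hl : 0 < l) {Q : ℝ → ℂ} (hQ : BddMeasurable Q)
    {ψ : C(Icc (0 : ℝ) 1, ℂ)}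
    (hψ : ∀ x : Icc (0 : ℝ) 1, ψ x + volterraCLM l hl Q hQ ψ x = (Real.exp (-(l * x)) : ℂ)) :
    ∃ y p, IsODESol 1 Q y p ∧ y 0 = 1 ∧ p 0 = 0 ∧
      EqOn y (fun x ↦ (Real.exp (l * x) : ℂ) * extend ψ x) (Icc 0 1) := by
  have h0 : (0 : ℝ) ∈ Icc (0 : ℝ) 1 := by simp
  -- Undoing the weight turns the fixed point equation into the Volterra equation with right-hand
  -- side `1`.
  set φ : ℝ → ℂ := fun x ↦ (Real.exp (l * x) : ℂ) * extend ψ x with hφ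
  have hφc : Continuous φ := by
    have := continuous_extend ψ
    fun_prop
  have hφeq : ∀ x ∈ Icc (0 : ℝ) 1,
      φ x = 1 + ∫ s in (0 : ℝ)..x, ((x - s : ℝ) : ℂ) * (-1 * Q s * φ s) := by
    intro x hx
    have h1 := hψ ⟨x, hx⟩
    rw [volterraCLM_apply, ← extend_apply] at h1
    simp only at h1
    simp only [hφ]
    rw [eq_sub_of_add_eq h1, mul_sub, ← Complex.ofReal_mul, ← Real.exp_add, add_neg_cancel,
      Real.exp_zero, Complex.ofReal_one, volterraFun, sub_eq_add_neg, add_right_inj,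
      ← intervalIntegral.integral_const_mul, ← intervalIntegral.integral_neg]
    refine intervalIntegral.integral_congr fun s _ ↦ ?_
    have : Real.exp (-(l * (x - s))) = (Real.exp (l * x))⁻¹ * Real.exp (l * s) := by
      rw [← Real.exp_neg, ← Real.exp_add]
      congr 1
      ring
    have hne : (Real.exp (l * x) : ℂ) ≠ 0 := by exact_mod_cast (Real.exp_pos _).ne'
    simp only [volterraKernel]
    rw [this]
    push_cast at hne ⊢
    field_simp
  have hg : BddMeasurable fun s ↦ -1 * Q s * φ s := (hQ.const_mul (-1)).mul_continuous hφc
  set p : ℝ → ℂ := fun x ↦ ∫ s in (0 : ℝ)..x, -1 * Q s * φ s with hp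
  have hp0 : p 0 = 0 := by simp [hp]
  have hφ0 : φ 0 = 1 := by simpa using hφeq 0 h0
  have hpc : ContinuousOn p (Icc 0 1) := hg.continuousOn_integral
  obtain ⟨y, p', hs, hy, hp'⟩ := IsODESol.exists_of_eqOn (c := 1) (B := Q) (y := φ) (p := p) hpc
    (fun x hx ↦ by
      have hw : ∀ t, HasDerivAt (fun t : ℝ ↦ ((x - t : ℝ) : ℂ)) (-1) t := fun t ↦ by
        simpa using ((hasDerivAt_id t).const_sub x).ofReal_comp
      have hwc : Continuous fun t : ℝ ↦ ((x - t : ℝ) : ℂ) := by fun_prop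
      have key := integral_by_parts (f := p) hg (fun t _ ↦ by rw [hp0, zero_add]) hw
        continuous_const hx
      rw [intervalIntegral.integral_add ((hg.mul_continuous hwc).intervalIntegrable h0 hx)
        (ContinuousOn.intervalIntegrable (u := fun t ↦ p t * -1)
          ((hpc.mono (uIcc_subset_Icc h0 hx)).mul continuousOn_const))] at key
      simp only [mul_neg, mul_one, intervalIntegral.integral_neg, sub_self, Complex.ofReal_zero,
        mul_zero, sub_zero, hp0, zero_mul] at key
      rw [hφ0, hφeq x hx]
      simp only [mul_comm (((x - _ : ℝ) : ℂ))]
      linear_combination key) (fun x _ ↦ by rw [hp0, zero_add])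
  exact ⟨y, p', hs, (hy h0).trans hφ0, (hp' h0).trans hp0, hy⟩

/-- Solutions of a linear equation near an identity depend smoothly on parameters. -/
lemma exists_contDiffAt_solution {E X ι : Type*} [NormedAddCommGroup E] [NormedSpace ℂ E]
    [NormedSpace ℝ E] [IsScalarTower ℝ ℂ E] [CompleteSpace E] [NormedAddCommGroup X]
    [NormedSpace ℝ X] [Fintype ι]
    (T : ι → E →L[ℂ] E) {a : ι → X → ℂ} {z₀ : X} (ha : ∀ j, ContDiffAt ℝ 1 (a j) z₀)
    (hT : ‖∑ j, a j z₀ • T j‖ < 1) (e : E) :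
    ∃ Ψ : X → E, ContDiffAt ℝ 1 Ψ z₀ ∧ ∀ᶠ z in 𝓝 z₀, Ψ z + (∑ j, a j z • T j) (Ψ z) = e := by
  set A : X → (E →L[ℂ] E) := fun z ↦ 1 + ∑ j, a j z • T j with hA
  have hAd : ContDiffAt ℝ 1 A z₀ :=
    contDiffAt_const.add (ContDiffAt.sum fun j _ ↦ (ha j).smul contDiffAt_const)
  have hunit : IsUnit (A z₀) := by
    rw [← norm_neg] at hT
    simpa only [sub_neg_eq_add] using isUnit_one_sub_of_norm_lt_one hT
  refine ⟨fun z ↦ Ring.inverse (A z) e, ?_, ?_⟩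
  · have h1 : ContDiffAt ℝ 1 Ring.inverse (A z₀) := by
      obtain ⟨u, hu⟩ := hunit
      rw [← hu]
      exact (contDiffAt_ringInverse ℂ u).restrict_scalars ℝ
    exact (((ContinuousLinearMap.apply ℂ E e).restrictScalars
      ℝ).contDiff.contDiffAt).comp z₀ (h1.comp z₀ hAd)
  · have hev : ∀ᶠ z in 𝓝 z₀, IsUnit (A z) :=
      hAd.continuousAt.eventually (Units.isOpen.mem_nhds hunit)
    filter_upwards [hev] with z hz
    change A z (Ring.inverse (A z) e) = e
    rw [← mul_apply_eq_comp, Ring.mul_inverse_cancel _ hz,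
      one_apply_eq_self]

/-- Existence of solutions, and their smooth dependence on parameters. -/
theorem exists_smooth_family {X ι : Type*} [NormedAddCommGroup X] [NormedSpace ℝ X] [Fintype ι]
    {V : ι → ℝ → ℂ} (hV : ∀ j, BddMeasurable (V j)) {a : ι → X → ℂ} {z₀ : X}
    (ha : ∀ j, ContDiffAt ℝ 1 (a j) z₀) :
    ∃ Y P : X → ℝ → ℂ, (∀ᶠ z in 𝓝 z₀, IsODESol 1 (fun x ↦ ∑ j, a j z * V j x) (Y z) (P z) ∧
        Y z 0 = 1 ∧ P z 0 = 0) ∧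
      (∀ g, BddMeasurable g →
        ContDiffAt ℝ 1 (fun z ↦ ∫ s in (0 : ℝ)..1, g s * Y z s) z₀) ∧
      ContDiffAt ℝ 1 (fun z ↦ Y z 1) z₀ := by
  have m1 : (1 : ℝ) ∈ Icc (0 : ℝ) 1 := by simp
  have m0 : (0 : ℝ) ∈ Icc (0 : ℝ) 1 := by simp
  have hQ := fun z ↦ BddMeasurable.sum hV fun j ↦ a j z
  obtain ⟨C, hC⟩ := (hQ z₀).bdd
  have hC0 : 0 ≤ C := (norm_nonneg _).trans (hC 0 (by simp))
  -- Any `l > C` would do, the norm at `z₀` being at most `C / l`.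
  set l : ℝ := C + 1 with hldef
  have hl : 0 < l := by positivity
  have hlt : ‖∑ j, a j z₀ • volterraCLM l hl (V j) (hV j)‖ < 1 := by
    rw [sum_volterraCLM]
    refine (norm_volterraCLM_le hl (hQ z₀) hC).trans_lt ?_
    rw [one_div, inv_mul_lt_iff₀ hl]
    linarith
  obtain ⟨Ψ, hΨd, hΨ⟩ := exists_contDiffAt_solution (fun j ↦ volterraCLM l hl (V j) (hV j)) ha hlt
    ⟨fun x ↦ (Real.exp (-(l * x)) : ℂ), by fun_prop⟩
  have hsol : ∀ᶠ z in 𝓝 z₀, ∃ y p, IsODESol 1 (fun x ↦ ∑ j, a j z * V j x) y p ∧ y 0 = 1 ∧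
      p 0 = 0 ∧ EqOn y (fun x ↦ (Real.exp (l * x) : ℂ) * extend (Ψ z) x) (Icc 0 1) := by
    filter_upwards [hΨ] with z hz
    refine exists_isODESol_of_volterra hl (hQ z) fun x ↦ ?_
    rw [sum_volterraCLM] at hz
    exact congrArg (fun f : C(Icc (0 : ℝ) 1, ℂ) ↦ f x) hz
  set S : Set X := {z | ∃ y p, IsODESol 1 (fun x ↦ ∑ j, a j z * V j x) y p ∧ y 0 = 1 ∧
      p 0 = 0 ∧ EqOn y (fun x ↦ (Real.exp (l * x) : ℂ) * extend (Ψ z) x) (Icc 0 1)} with hS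
  have hYP : ∀ z, z ∈ S → ∃ y p, IsODESol 1 (fun x ↦ ∑ j, a j z * V j x) y p ∧ y 0 = 1 ∧
      p 0 = 0 ∧ EqOn y (fun x ↦ (Real.exp (l * x) : ℂ) * extend (Ψ z) x) (Icc 0 1) := fun _ h ↦ h
  choose! Y P hYP using hYP
  have hev : ∀ᶠ z in 𝓝 z₀, z ∈ S := hsol
  refine ⟨Y, P, hev.mono fun z hz ↦ ⟨(hYP z hz).1, (hYP z hz).2.1, (hYP z hz).2.2.1⟩, ?_, ?_⟩
  · intro g hg
    have hge : BddMeasurable fun s ↦ g s * (Real.exp (l * s) : ℂ) :=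
      hg.mul_continuous (by fun_prop)
    have h1 : ContDiffAt ℝ 1 (fun z ↦ integralCLM _ hge (Ψ z)) z₀ :=
      (((integralCLM _ hge).restrictScalars ℝ).contDiff.contDiffAt).comp z₀ hΨd
    refine h1.congr_of_eventuallyEq (hev.mono fun z hz ↦ ?_)
    simp only [integralCLM_apply]
    refine intervalIntegral.integral_congr fun t ht ↦ ?_
    rw [(hYP z hz).2.2.2 (uIcc_subset_Icc m0 m1 ht), mul_assoc]
  · have h1 : ContDiffAt ℝ 1 (fun z ↦ (Real.exp (l * 1) : ℂ) * Ψ z ⟨1, m1⟩) z₀ :=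
      contDiffAt_const.mul (((((ContinuousMap.evalCLM ℂ (⟨1, m1⟩ : Icc (0 : ℝ) 1) :
        C(Icc (0 : ℝ) 1, ℂ) →L[ℂ] ℂ)).restrictScalars ℝ).contDiff.contDiffAt).comp z₀ hΨd)
    refine h1.congr_of_eventuallyEq (hev.mono fun z hz ↦ ?_)
    change Y z 1 = (Real.exp (l * 1) : ℂ) * Ψ z ⟨1, m1⟩
    rw [(hYP z hz).2.2.2 m1, ← extend_apply]

/-! ### Structures bounded at every point. -/

/-- The structures that are measurable and satisfy the constraint at every point. -/
def structures (b₁ b₂ : ℝ) : Set (ℝ → ℝ) :=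
  {B | Measurable B ∧ ∀ x, b₁ ≤ B x ∧ B x ≤ b₂}

lemma structures_subset_admissible (b₁ b₂ : ℝ) : structures b₁ b₂ ⊆ admissible b₁ b₂ :=
  fun _ h ↦ ⟨h.1.aestronglyMeasurable, Eventually.of_forall h.2⟩

lemma bddMeasurable_of_mem_structures {b₁ b₂ : ℝ} {B : ℝ → ℝ} (h : B ∈ structures b₁ b₂) :
    BddMeasurable fun x ↦ (B x : ℂ) := by
  refine ⟨Complex.measurable_ofReal.comp h.1, max |b₁| |b₂|, fun x _ ↦ ?_⟩
  rw [Complex.norm_real]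
  exact abs_le_max_abs_abs (h.2 x).1 (h.2 x).2

/-- A measurable representative is clamped to `[b₁, b₂]`, which alters it only on a null set. -/
lemma exists_mem_structures {b₁ b₂ : ℝ} (hb : b₁ ≤ b₂) {B : ℝ → ℝ} (h : B ∈ admissible b₁ b₂) :
    ∃ B₀ ∈ structures b₁ b₂, B =ᵐ[volume.restrict (Ioo 0 1)] B₀ := by
  refine ⟨fun x ↦ max b₁ (min b₂ (h.1.mk B x)), ⟨?_, fun x ↦ ⟨le_max_left _ _,
    max_le hb (min_le_left _ _)⟩⟩, ?_⟩
  · exact measurable_const.max (measurable_const.min h.1.stronglyMeasurable_mk.measurable)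
  · filter_upwards [h.1.ae_eq_mk, h.2] with x hx1 hx2
    rw [← hx1, min_eq_right hx2.2, max_eq_right hx2.1]

namespace IsODESol

lemma congr_potential {c c' : ℂ} {B B' y p : ℝ → ℂ} (h : IsODESol c B y p)
    (hcB : ∀ x, c * B x = c' * B' x) : IsODESol c' B' y p where
  hasDerivAt := h.hasDerivAt
  continuous_deriv := h.continuous_deriv
  deriv_eq x hx := by
    rw [h.deriv_eq x hx]
    simp only [neg_mul, hcB]

lemma sub {c : ℂ} {B y₁ p₁ y₂ p₂ : ℝ → ℂ} (h₁ : IsODESol c B y₁ p₁) (h₂ : IsODESol c B y₂ p₂)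
    (hB : BddMeasurable B) : IsODESol c B (fun x ↦ y₁ x - y₂ x) (fun x ↦ p₁ x - p₂ x) where
  hasDerivAt x := (h₁.hasDerivAt x).sub (h₂.hasDerivAt x)
  continuous_deriv := h₁.continuous_deriv.sub h₂.continuous_deriv
  deriv_eq x hx := by
    have h0 : (0 : ℝ) ∈ Icc (0 : ℝ) 1 := by simp
    rw [h₁.deriv_eq x hx, h₂.deriv_eq x hx]
    simp only [mul_sub]
    rw [intervalIntegral.integral_sub ((h₁.bddMeasurable hB).intervalIntegrable h0 hx)
      ((h₂.bddMeasurable hB).intervalIntegrable h0 hx)]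
    ring

lemma eqOn_of_initial {c : ℂ} {B y₁ p₁ y₂ p₂ : ℝ → ℂ} (h₁ : IsODESol c B y₁ p₁)
    (h₂ : IsODESol c B y₂ p₂) (hB : BddMeasurable B) (hy : y₁ 0 = y₂ 0) (hp : p₁ 0 = p₂ 0) :
    EqOn y₁ y₂ (Icc 0 1) := fun x hx ↦
  sub_eq_zero.1 ((h₁.sub h₂ hB).eq_zero_of_initial hB (sub_eq_zero.2 hy) (sub_eq_zero.2 hp) x hx)

end IsODESol

/-! ### Moving a quasi-eigenvalue straight down. -/

/-- Zeros of a function whose partial derivative in the second variable is the identity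
and whose partial derivative in the first variable vanishes. -/
lemma exists_zero_of_hasStrictFDerivAt {R : ℝ × ℂ → ℂ}
    (hR : HasStrictFDerivAt R (ContinuousLinearMap.snd ℝ ℝ ℂ) 0) (hR0 : R 0 = 0)
    {U : Set (ℝ × ℂ)} (hU : U ∈ 𝓝 0) :
    ∃ s u, 0 < s ∧ ‖u‖ < s ∧ (s, u) ∈ U ∧ R (s, u) = 0 := by
  -- Keeping the first coordinate makes the derivative at `0` the identity; the local inverse then
  -- maps `(s, 0)` to a zero of `R` with first coordinate `s`.
  set Φ : ℝ × ℂ → ℝ × ℂ := fun z ↦ (z.1, R z) with hΦ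
  have hΦd : HasStrictFDerivAt Φ
      (ContinuousLinearEquiv.refl ℝ (ℝ × ℂ) : (ℝ × ℂ) →L[ℝ] (ℝ × ℂ)) 0 := by
    have h := hasStrictFDerivAt_fst.prodMk hR
    convert! h using 1
  have hΦ0 : Φ 0 = 0 := by simp [hΦ, hR0]
  set g := hΦd.localInverse Φ _ 0 with hg
  have hgd : HasStrictFDerivAt g ((ContinuousLinearEquiv.refl ℝ (ℝ × ℂ)).symm :
      (ℝ × ℂ) →L[ℝ] (ℝ × ℂ)) 0 := by
    have := hΦd.to_localInverse
    rwa [hΦ0] at this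
  have hg0 : g 0 = 0 := by
    have := hΦd.localInverse_apply_image
    rwa [hΦ0] at this
  have hgr : ∀ᶠ z in 𝓝 (0 : ℝ × ℂ), Φ (g z) = z := by
    have := hΦd.eventually_right_inverse
    rwa [hΦ0] at this
  have hgU : ∀ᶠ z in 𝓝 (0 : ℝ × ℂ), g z ∈ U := by
    have : ContinuousAt g 0 := hgd.continuousAt
    exact this.eventually (by rw [hg0]; exact hU)
  -- With constant `1/2` the second coordinate `u` of `g (s, 0)` satisfies `‖u‖ ≤ s / 2 < s`.
  have hgo : ∀ᶠ z in 𝓝 (0 : ℝ × ℂ), ‖g z - z‖ ≤ 1 / 2 * ‖z‖ := by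
    have := (hasFDerivAt_iff_isLittleO_nhds_zero.1 hgd.hasFDerivAt).def
      (by norm_num : (0 : ℝ) < 1 / 2)
    simpa [hg0] using this
  have hlim : Tendsto (fun s : ℝ ↦ ((s, 0) : ℝ × ℂ)) (𝓝[>] 0) (𝓝 0) := by
    have : Continuous fun s : ℝ ↦ ((s, 0) : ℝ × ℂ) := by fun_prop
    exact (this.tendsto 0).mono_left nhdsWithin_le_nhds
  obtain ⟨s, ⟨⟨hs1, hs2⟩, hs3⟩, hs4⟩ := (((hlim.eventually hgr).and (hlim.eventually hgU)).and
    (hlim.eventually hgo)).and self_mem_nhdsWithin |>.exists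
  have hs : 0 < s := hs4
  have e1 : (g (s, 0)).1 = s := congrArg Prod.fst hs1
  have e2 : R (g (s, 0)) = 0 := congrArg Prod.snd hs1
  have e3 : g (s, 0) = (s, (g (s, 0)).2) := Prod.ext e1 rfl
  refine ⟨s, (g (s, 0)).2, hs, ?_, by rwa [← e3], by rwa [← e3]⟩
  have h0 : (g (s, 0) - ((s, 0) : ℝ × ℂ)).2 = (g (s, 0)).2 := by rw [Prod.snd_sub, sub_zero]
  have h1 : ‖(g (s, 0)).2‖ ≤ ‖g (s, 0) - (s, 0)‖ := h0 ▸ norm_snd_le _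
  have h2 : ‖((s, 0) : ℝ × ℂ)‖ = s := by simp [Prod.norm_def, abs_of_pos hs, hs.le]
  rw [h2] at hs3
  linarith

lemma hasStrictFDerivAt_mul_of_eq_zero {E : Type*} [NormedAddCommGroup E] [NormedSpace ℝ E]
    {a h : E → ℂ} {a' : E →L[ℝ] ℂ} {x : E} (ha : HasStrictFDerivAt a a' x) (hax : a x = 0)
    (hh : ContDiffAt ℝ 1 h x) : HasStrictFDerivAt (fun z ↦ a z * h z) (h x • a') x := by
  refine (ha.mul (hh.hasStrictFDerivAt one_ne_zero)).congr_fderiv ?_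
  exact ContinuousLinearMap.ext fun v ↦ by simp [hax]

/-- If the first variations of the characteristic function in admissible directions positively
span the plane, then the quasi-eigenvalue can be moved straight down. -/
theorem exists_lower_quasiEigenvalue {b₁ b₂ : ℝ} {κ : ℂ} (hκ : κ ≠ 0) {B : ℝ → ℝ}
    (hB : B ∈ structures b₁ b₂) {y p : ℝ → ℂ} (h : IsODESol (κ ^ 2) (fun x ↦ (B x : ℂ)) y p)
    (hy0 : y 0 = 1) (hp0 : p 0 = 0) (hp1 : p 1 = -Complex.I * κ * y 1) (hy1 : y 1 ≠ 0)
    (hspan : ∀ z : ℂ, ∃ τ : ℝ, 0 ≤ τ ∧ ∃ B' ∈ structures b₁ b₂,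
      κ ^ 2 * τ * ∫ x in (0 : ℝ)..1, ((B' x : ℂ) - B x) * (y x * y x) = z) :
    ∃ B' ∈ structures b₁ b₂, ∃ κ' ∈ quasiEigenvalues B', κ'.re = κ.re ∧ κ'.im < κ.im := by
  -- The three variations `1`, `I`, `-1 - I` sum to zero. Giving each the weight `s` costs nothing
  -- at first order and leaves room to add `u.re` and `u.im` while the weights stay nonnegative.
  obtain ⟨τ₁, hτ₁, B₁, hB₁, h₁⟩ := hspan 1
  obtain ⟨τ₂, hτ₂, B₂, hB₂, h₂⟩ := hspan Complex.I
  obtain ⟨τ₃, hτ₃, B₃, hB₃, h₃⟩ := hspan (-1 - Complex.I)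
  have hBb := bddMeasurable_of_mem_structures hB
  have hV₁ := (bddMeasurable_of_mem_structures hB₁).sub hBb
  have hV₂ := (bddMeasurable_of_mem_structures hB₂).sub hBb
  have hV₃ := (bddMeasurable_of_mem_structures hB₃).sub hBb
  -- The downward shift is `s²`, so that it does not contribute to the derivative at `0`.
  set κt : ℝ × ℂ → ℂ := fun z ↦ κ - Complex.I * (z.1 : ℂ) ^ 2 with hκt
  set a : Fin 4 → ℝ × ℂ → ℂ := ![fun z ↦ κt z ^ 2, fun z ↦ κt z ^ 2 * (τ₁ * (z.1 + z.2.re)),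
    fun z ↦ κt z ^ 2 * (τ₂ * (z.1 + z.2.im)), fun z ↦ κt z ^ 2 * (τ₃ * z.1)] with ha
  set V : Fin 4 → ℝ → ℂ := ![fun x ↦ (B x : ℂ), fun x ↦ (B₁ x : ℂ) - B x,
    fun x ↦ (B₂ x : ℂ) - B x, fun x ↦ (B₃ x : ℂ) - B x] with hV
  have hVb : ∀ j, BddMeasurable (V j) := by
    intro j
    fin_cases j <;> assumption
  have d1 : ContDiff ℝ 1 fun z : ℝ × ℂ ↦ (z.1 : ℂ) := Complex.ofRealCLM.contDiff.comp contDiff_fst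
  have d2 : ContDiff ℝ 1 fun z : ℝ × ℂ ↦ (z.2.re : ℂ) :=
    Complex.ofRealCLM.contDiff.comp (Complex.reCLM.contDiff.comp contDiff_snd)
  have d3 : ContDiff ℝ 1 fun z : ℝ × ℂ ↦ (z.2.im : ℂ) :=
    Complex.ofRealCLM.contDiff.comp (Complex.imCLM.contDiff.comp contDiff_snd)
  have dκ : ContDiff ℝ 1 κt := contDiff_const.sub (contDiff_const.mul (d1.pow 2))
  have had : ∀ j, ContDiffAt ℝ 1 (a j) 0 := by
    intro j
    refine ContDiff.contDiffAt ?_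
    fin_cases j
    · exact dκ.pow 2
    · exact (dκ.pow 2).mul (contDiff_const.mul (d1.add d2))
    · exact (dκ.pow 2).mul (contDiff_const.mul (d1.add d3))
    · exact (dκ.pow 2).mul (contDiff_const.mul d1)
  obtain ⟨Y, P, hYP, hYg, hY1⟩ := exists_smooth_family hVb had
  set m : Fin 4 → ℝ × ℂ → ℂ := fun j z ↦ ∫ s in (0 : ℝ)..1, (V j s * y s) * Y z s with hm
  have hmb : ∀ j, BddMeasurable fun s ↦ V j s * y s := fun j ↦
    (hVb j).mul_continuous h.continuous
  have hmd : ∀ j, ContDiffAt ℝ 1 (m j) 0 := fun j ↦ hYg _ (hmb j)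
  have hm0 : ∀ j, m j 0 = ∫ s in (0 : ℝ)..1, V j s * (y s * y s) := by
    intro j
    obtain ⟨hs, hs0, hs1⟩ := hYP.self_of_nhds
    have hs' : IsODESol (κ ^ 2) (fun x ↦ (B x : ℂ)) (Y 0) (P 0) := by
      refine hs.congr_potential fun x ↦ ?_
      simp [ha, hV, Fin.sum_univ_four, hκt]
    have heq := hs'.eqOn_of_initial h hBb (hs0.trans hy0.symm) (hs1.trans hp0.symm)
    refine intervalIntegral.integral_congr fun t ht ↦ ?_
    rw [uIcc_of_le zero_le_one] at ht
    simp only [heq ht, mul_assoc]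
  -- By the Wronskian identity with `y`, near `0` this is `-y 1` times the boundary defect `P z 1 +
  -- I κt z Y z 1`. Each summand carries a factor vanishing at `0`, so only the values of the other
  -- factors enter the derivative.
  set R : ℝ × ℂ → ℂ := fun z ↦ (z.1 : ℂ) * (z.1 * (-2 * Complex.I * κ - (z.1 : ℂ) ^ 2) * m 0 z -
      z.1 * (y 1 * Y z 1) + κt z ^ 2 * τ₃ * m 3 z) +
      (z.1 + z.2.re) * (κt z ^ 2 * τ₁ * m 1 z) + (z.1 + z.2.im) * (κt z ^ 2 * τ₂ * m 2 z) with hR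
  have hRd : HasStrictFDerivAt R (ContinuousLinearMap.snd ℝ ℝ ℂ) 0 := by
    have l1 : HasStrictFDerivAt (fun z : ℝ × ℂ ↦ (z.1 : ℂ))
        (Complex.ofRealCLM.comp (ContinuousLinearMap.fst ℝ ℝ ℂ)) 0 :=
      (Complex.ofRealCLM.comp (ContinuousLinearMap.fst ℝ ℝ ℂ)).hasStrictFDerivAt
    have l2 : HasStrictFDerivAt (fun z : ℝ × ℂ ↦ (z.2.re : ℂ))
        (Complex.ofRealCLM.comp (Complex.reCLM.comp (ContinuousLinearMap.snd ℝ ℝ ℂ))) 0 :=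
      (Complex.ofRealCLM.comp
        (Complex.reCLM.comp (ContinuousLinearMap.snd ℝ ℝ ℂ))).hasStrictFDerivAt
    have l3 : HasStrictFDerivAt (fun z : ℝ × ℂ ↦ (z.2.im : ℂ))
        (Complex.ofRealCLM.comp (Complex.imCLM.comp (ContinuousLinearMap.snd ℝ ℝ ℂ))) 0 :=
      (Complex.ofRealCLM.comp
        (Complex.imCLM.comp (ContinuousLinearMap.snd ℝ ℝ ℂ))).hasStrictFDerivAt
    have p1 := hasStrictFDerivAt_mul_of_eq_zero l1 (by simp)
      (((d1.contDiffAt.mul (contDiffAt_const.sub (d1.contDiffAt.pow 2))).mul (hmd 0)).sub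
        (d1.contDiffAt.mul (contDiffAt_const.mul hY1)) |>.add
        (((dκ.contDiffAt.pow 2).mul contDiffAt_const).mul (hmd 3)) :
        ContDiffAt ℝ 1 (fun z : ℝ × ℂ ↦ z.1 * (-2 * Complex.I * κ - (z.1 : ℂ) ^ 2) * m 0 z -
          z.1 * (y 1 * Y z 1) + κt z ^ 2 * τ₃ * m 3 z) 0)
    have p2 := hasStrictFDerivAt_mul_of_eq_zero (l1.add l2) (by simp)
      (((dκ.contDiffAt.pow 2).mul contDiffAt_const).mul (hmd 1) :
        ContDiffAt ℝ 1 (fun z : ℝ × ℂ ↦ κt z ^ 2 * τ₁ * m 1 z) 0)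
    have p3 := hasStrictFDerivAt_mul_of_eq_zero (l1.add l3) (by simp)
      (((dκ.contDiffAt.pow 2).mul contDiffAt_const).mul (hmd 2) :
        ContDiffAt ℝ 1 (fun z : ℝ × ℂ ↦ κt z ^ 2 * τ₂ * m 2 z) 0)
    have e1 : κt 0 ^ 2 * τ₁ * m 1 0 = 1 := by
      rw [hm0, ← h₁]
      simp [hκt, hV]
    have e2 : κt 0 ^ 2 * τ₂ * m 2 0 = Complex.I := by
      rw [hm0, ← h₂]
      simp [hκt, hV]
    have e3 : κt 0 ^ 2 * τ₃ * m 3 0 = -1 - Complex.I := by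
      rw [hm0, ← h₃]
      simp [hκt, hV]
    have p := (p1.add p2).add p3
    rw [e1, e2, e3] at p
    convert! p using 1
    refine ContinuousLinearMap.ext fun z ↦ ?_
    simp only [ContinuousLinearMap.coe_snd', Prod.fst_zero, Complex.ofReal_zero, zero_mul,
      sub_zero, zero_add, _root_.add_apply, _root_.smul_apply, ContinuousLinearMap.comp_apply,
      ContinuousLinearMap.coe_fst', Complex.ofRealCLM_apply, Complex.reCLM_apply,
      Complex.imCLM_apply, smul_eq_mul]
    conv_lhs => rw [← Complex.re_add_im z.2]
    ring
  have hR0 : R 0 = 0 := by simp [hR]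
  -- The last condition keeps the weight of `B` nonnegative, since `s + u.re` and `s + u.im` are
  -- below `2 s`.
  have hU : ∀ᶠ z in 𝓝 (0 : ℝ × ℂ), (IsODESol 1 (fun x ↦ ∑ j, a j z * V j x) (Y z) (P z) ∧
      Y z 0 = 1 ∧ P z 0 = 0) ∧ κt z ≠ 0 ∧ z.1 * (2 * τ₁ + 2 * τ₂ + τ₃) < 1 := by
    refine hYP.and ((dκ.continuous.continuousAt.eventually_ne (by simpa [hκt])).and ?_)
    have : Continuous fun z : ℝ × ℂ ↦ z.1 * (2 * τ₁ + 2 * τ₂ + τ₃) := by fun_prop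
    exact this.continuousAt.eventually_lt continuousAt_const (by simp)
  obtain ⟨s, u, hs, hu, ⟨⟨hsol, hY0, hP0⟩, hκ', hsmall⟩, hzero⟩ :=
    exists_zero_of_hasStrictFDerivAt hRd hR0 hU
  simp only at hsmall
  have hre := abs_lt.1 ((Complex.abs_re_le_norm u).trans_lt hu)
  have him := abs_lt.1 ((Complex.abs_im_le_norm u).trans_lt hu)
  have hw₁ : 0 ≤ τ₁ * (s + u.re) := mul_nonneg hτ₁ (by linarith)
  have hw₂ : 0 ≤ τ₂ * (s + u.im) := mul_nonneg hτ₂ (by linarith)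
  have hw₃ : 0 ≤ τ₃ * s := mul_nonneg hτ₃ hs.le
  have hw : τ₁ * (s + u.re) + τ₂ * (s + u.im) + τ₃ * s ≤ 1 := by
    have i1 : τ₁ * (s + u.re) ≤ τ₁ * (2 * s) := mul_le_mul_of_nonneg_left (by linarith) hτ₁
    have i2 : τ₂ * (s + u.im) ≤ τ₂ * (2 * s) := mul_le_mul_of_nonneg_left (by linarith) hτ₂
    linarith
  set w₁ := τ₁ * (s + u.re) with hw₁d
  set w₂ := τ₂ * (s + u.im) with hw₂d
  set w₃ := τ₃ * s with hw₃d
  set B' : ℝ → ℝ := fun x ↦ (1 - w₁ - w₂ - w₃) * B x + w₁ * B₁ x + w₂ * B₂ x + w₃ * B₃ x with hB'd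
  have hB' : B' ∈ structures b₁ b₂ := by
    refine ⟨(((hB.1.const_mul _).add (hB₁.1.const_mul _)).add (hB₂.1.const_mul _)).add
      (hB₃.1.const_mul _), fun x ↦ ?_⟩
    have hw₀ : 0 ≤ 1 - w₁ - w₂ - w₃ := by linarith
    have j0 := mul_le_mul_of_nonneg_left (hB.2 x).1 hw₀
    have j1 := mul_le_mul_of_nonneg_left (hB₁.2 x).1 hw₁
    have j2 := mul_le_mul_of_nonneg_left (hB₂.2 x).1 hw₂
    have j3 := mul_le_mul_of_nonneg_left (hB₃.2 x).1 hw₃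
    have k0 := mul_le_mul_of_nonneg_left (hB.2 x).2 hw₀
    have k1 := mul_le_mul_of_nonneg_left (hB₁.2 x).2 hw₁
    have k2 := mul_le_mul_of_nonneg_left (hB₂.2 x).2 hw₂
    have k3 := mul_le_mul_of_nonneg_left (hB₃.2 x).2 hw₃
    simp only [hB'd]
    constructor <;> linarith
  have hQ : ∀ x, ∑ j, a j (s, u) * V j x = κt (s, u) ^ 2 * (B' x : ℂ) := by
    intro x
    simp only [Fin.sum_univ_four, ha, hV, hB'd, hw₁d, hw₂d, hw₃d, Matrix.cons_val]
    push_cast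
    ring
  have hsol' : IsODESol (κt (s, u) ^ 2) (fun x ↦ (B' x : ℂ)) (Y (s, u)) (P (s, u)) :=
    hsol.congr_potential fun x ↦ by rw [one_mul, hQ]
  have hB'b := bddMeasurable_of_mem_structures hB'
  have hwr := h.wronskian hsol' hBb hB'b (x := 1) (by simp)
  have hmi : ∀ j, IntervalIntegrable (fun t ↦ V j t * y t * Y (s, u) t) volume 0 1 := fun j ↦
    ((hmb j).mul_continuous hsol'.continuous).intervalIntegrable (by simp) (by simp)
  have hI : ∫ t in (0 : ℝ)..1, (κt (s, u) ^ 2 * (B' t : ℂ) - κ ^ 2 * B t) * (y t * Y (s, u) t) =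
      (κt (s, u) ^ 2 - κ ^ 2) * m 0 (s, u) + κt (s, u) ^ 2 * w₁ * m 1 (s, u) +
        κt (s, u) ^ 2 * w₂ * m 2 (s, u) + κt (s, u) ^ 2 * w₃ * m 3 (s, u) := by
    simp only [hm]
    rw [← intervalIntegral.integral_const_mul, ← intervalIntegral.integral_const_mul,
      ← intervalIntegral.integral_const_mul, ← intervalIntegral.integral_const_mul,
      ← intervalIntegral.integral_add, ← intervalIntegral.integral_add,
      ← intervalIntegral.integral_add]
    · refine intervalIntegral.integral_congr fun t _ ↦ ?_
      simp only [hV, hB'd, Matrix.cons_val]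
      push_cast
      ring
    · exact (((hmi 0).const_mul _).add ((hmi 1).const_mul _)).add ((hmi 2).const_mul _)
    · exact (hmi 3).const_mul _
    · exact ((hmi 0).const_mul _).add ((hmi 1).const_mul _)
    · exact (hmi 2).const_mul _
    · exact (hmi 0).const_mul _
    · exact (hmi 1).const_mul _
  rw [hI, hp1, hp0, hP0, hY0, hy0] at hwr
  have hP1 : P (s, u) 1 = -Complex.I * κt (s, u) * Y (s, u) 1 := by
    refine mul_left_cancel₀ hy1 ?_
    simp only [hR] at hzero
    have hκe : κt (s, u) = κ - Complex.I * (s : ℂ) ^ 2 := rfl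
    have hκ2 : κt (s, u) ^ 2 - κ ^ 2 = s * (s * (-2 * Complex.I * κ - (s : ℂ) ^ 2)) := by
      rw [hκe]
      linear_combination (s : ℂ) ^ 4 * Complex.I_sq
    rw [hκ2] at hwr
    have c1 : (w₁ : ℂ) = τ₁ * (s + u.re) := by simp [hw₁d]
    have c2 : (w₂ : ℂ) = τ₂ * (s + u.im) := by simp [hw₂d]
    have c3 : (w₃ : ℂ) = τ₃ * s := by simp [hw₃d]
    rw [c1, c2, c3] at hwr
    have hfin : y 1 * (Complex.I * κt (s, u) * Y (s, u) 1) =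
        y 1 * (Complex.I * κ * Y (s, u) 1) + s ^ 2 * (y 1 * Y (s, u) 1) := by
      rw [hκe]
      linear_combination (-(s : ℂ) ^ 2 * (y 1 * Y (s, u) 1)) * Complex.I_sq
    linear_combination hwr - hzero + hfin
  refine ⟨B', hB', κt (s, u), ⟨hκ', Y (s, u), hsol'.isSolution hκ' hB'b (EventuallyEq.refl _ _)
    hP0 hP1, 0, by simp, by simp [hY0]⟩, ?_, ?_⟩
  · simp [hκt, ← Complex.ofReal_pow]
  · simp only [hκt, ← Complex.ofReal_pow, Complex.sub_im, Complex.mul_im, Complex.I_re,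
      Complex.I_im, Complex.ofReal_re, Complex.ofReal_im]
    have : 0 < s ^ 2 := by positivity
    linarith

/-! ### The half-plane alternative and the bang-bang property. -/

/-- A convex cone in the plane that is not the whole plane lies in a half-plane. -/
lemma exists_im_mul_nonpos_of_cone {K : Set ℂ} (h0 : (0 : ℂ) ∈ K)
    (hadd : ∀ z ∈ K, ∀ w ∈ K, z + w ∈ K) (hsmul : ∀ t : ℝ, 0 ≤ t → ∀ z ∈ K, (t : ℂ) * z ∈ K)
    (hK : K ≠ univ) : ∃ μ : ℂ, μ ≠ 0 ∧ ∀ z ∈ K, (μ * z).im ≤ 0 := by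
  have hconv : Convex ℝ K := by
    intro z hz w hw a b ha hb _
    simpa using hadd _ (hsmul a ha z hz) _ (hsmul b hb w hw)
  suffices h : ∃ f : ℂ →ₗ[ℝ] ℝ, f ≠ 0 ∧ ∀ z ∈ K, f z ≤ 0 by
    obtain ⟨f, hf, hfK⟩ := h
    have hfz : ∀ z : ℂ, f z = ((⟨f Complex.I, f 1⟩ : ℂ) * z).im := by
      intro z
      have : z = z.re • (1 : ℂ) + z.im • Complex.I := by simp
      conv_lhs => rw [this]
      rw [map_add, map_smul, map_smul]
      simp only [smul_eq_mul, Complex.mul_im]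
      ring
    refine ⟨⟨f Complex.I, f 1⟩, fun h ↦ hf ?_, fun z hz ↦ by rw [← hfz]; exact hfK z hz⟩
    exact LinearMap.ext fun z ↦ by rw [hfz, h, zero_mul]; rfl
  -- With empty interior, `K` spans a proper subspace, killed by some functional; otherwise its
  -- interior is separated from a point outside `K`.
  rcases (interior K).eq_empty_or_nonempty with he | hne
  · have hspan : Submodule.span ℝ K < ⊤ := by
      refine lt_top_iff_ne_top.2 fun htop ↦ ?_
      have : (interior K).Nonempty := by
        rw [hconv.interior_nonempty_iff_affineSpan_eq_top,
          AffineSubspace.affineSpan_eq_top_iff_vectorSpan_eq_top_of_nonempty ℝ ℂ ℂ ⟨0, h0⟩,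
          eq_top_iff, ← htop, Submodule.span_le]
        intro z hz
        simpa using vsub_mem_vectorSpan ℝ hz h0
      exact this.ne_empty he
    obtain ⟨f, hf, hle⟩ := Submodule.exists_le_ker_of_lt_top _ hspan
    exact ⟨f, hf, fun z hz ↦ (hle (Submodule.subset_span hz)).le⟩
  · obtain ⟨z₀, hz₀⟩ := (ne_univ_iff_exists_notMem K).1 hK
    obtain ⟨f, hf⟩ := geometric_hahn_banach_open_point hconv.interior isOpen_interior
      (fun h ↦ hz₀ (interior_subset h))
    obtain ⟨w, hw⟩ := hne
    refine ⟨f, fun h ↦ ?_, fun z hz ↦ ?_⟩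
    · have := hf w hw
      have e : ∀ v, f v = 0 := fun v ↦ DFunLike.congr_fun h v
      rw [e, e] at this
      exact lt_irrefl _ this
    · have hcl : ∀ v ∈ K, f v ≤ f z₀ := by
        intro v hv
        have hv' : v ∈ closure (interior K) := by
          rw [hconv.closure_interior_eq_closure_of_nonempty_interior ⟨w, hw⟩]
          exact subset_closure hv
        exact closure_minimal (fun u hu ↦ (hf u hu).le)
          (isClosed_le f.continuous continuous_const) hv'
      by_contra hpos
      have hpos' : 0 < f z := not_le.1 hpos
      -- This multiple of `z` has `f`-value `|f z₀| + 1`, above the bound `f z₀`.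
      have := hcl _ (hsmul ((|f z₀| + 1) / f z) (by positivity) z hz)
      rw [← Complex.real_smul, map_smul, smul_eq_mul, div_mul_cancel₀ _ hpos'.ne'] at this
      linarith [le_abs_self (f z₀)]

lemma structures_convexComb {b₁ b₂ : ℝ} {B B' : ℝ → ℝ} (hB : B ∈ structures b₁ b₂)
    (hB' : B' ∈ structures b₁ b₂) {u v : ℝ} (hu : 0 ≤ u) (hv : 0 ≤ v) (huv : u + v = 1) :
    (fun x ↦ u * B x + v * B' x) ∈ structures b₁ b₂ :=
  ⟨(hB.1.const_mul u).add (hB'.1.const_mul v), fun x ↦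
    convex_Icc b₁ b₂ (hB.2 x) (hB'.2 x) hu hv huv⟩

/-- Either the first variations positively span the plane, or they lie in a half-plane. -/
lemma span_or_halfPlane {b₁ b₂ : ℝ} {κ : ℂ} (hκ : κ ≠ 0) {B : ℝ → ℝ}
    (hB : B ∈ structures b₁ b₂) {y : ℝ → ℂ} (hy : Continuous y) :
    (∀ z : ℂ, ∃ τ : ℝ, 0 ≤ τ ∧ ∃ B' ∈ structures b₁ b₂,
      κ ^ 2 * τ * ∫ x in (0 : ℝ)..1, ((B' x : ℂ) - B x) * (y x * y x) = z) ∨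
    ∃ μ : ℂ, μ ≠ 0 ∧ ∀ B' ∈ structures b₁ b₂,
      (μ * ∫ x in (0 : ℝ)..1, ((B' x : ℂ) - B x) * (y x * y x)).im ≤ 0 := by
  set D : (ℝ → ℝ) → ℂ := fun B' ↦ ∫ x in (0 : ℝ)..1, ((B' x : ℂ) - B x) * (y x * y x) with hD
  set K : Set ℂ := {z | ∃ τ : ℝ, 0 ≤ τ ∧ ∃ B' ∈ structures b₁ b₂, κ ^ 2 * τ * D B' = z} with hK
  have hint : ∀ B' ∈ structures b₁ b₂,
      IntervalIntegrable (fun x ↦ ((B' x : ℂ) - B x) * (y x * y x)) volume 0 1 := fun B' hB' ↦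
    (((bddMeasurable_of_mem_structures hB').sub
      (bddMeasurable_of_mem_structures hB)).mul_continuous (hy.mul hy)).intervalIntegrable
      (by simp) (by simp)
  -- `D` is affine, not linear, because of the subtracted `B`; hence `u + v = 1`.
  have hDc : ∀ B₁ ∈ structures b₁ b₂, ∀ B₂ ∈ structures b₁ b₂, ∀ u v : ℝ, u + v = 1 →
      D (fun x ↦ u * B₁ x + v * B₂ x) = u * D B₁ + v * D B₂ := by
    intro B₁ hB₁ B₂ hB₂ u v huv
    simp only [hD]
    rw [← intervalIntegral.integral_const_mul, ← intervalIntegral.integral_const_mul,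
      ← intervalIntegral.integral_add ((hint B₁ hB₁).const_mul _) ((hint B₂ hB₂).const_mul _)]
    refine intervalIntegral.integral_congr fun x _ ↦ ?_
    have : (u : ℂ) + v = 1 := by exact_mod_cast huv
    push_cast
    linear_combination ((B x : ℂ) * (y x * y x)) * this
  by_cases huniv : K = univ
  · left
    intro z
    exact huniv.ge (mem_univ z)
  · right
    have hadd : ∀ z ∈ K, ∀ w ∈ K, z + w ∈ K := by
      rintro _ ⟨τ, hτ, B₁, hB₁, rfl⟩ _ ⟨σ, hσ, B₂, hB₂, rfl⟩
      rcases (add_nonneg hτ hσ).eq_or_lt with h | h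
      · refine ⟨0, le_rfl, B, hB, ?_⟩
        rw [show τ = 0 by linarith, show σ = 0 by linarith]
        simp
      · have huv : τ / (τ + σ) + σ / (τ + σ) = 1 := by
          rw [← add_div, div_self h.ne']
        refine ⟨τ + σ, h.le, _, structures_convexComb hB₁ hB₂ (div_nonneg hτ h.le)
          (div_nonneg hσ h.le) huv, ?_⟩
        rw [hDc B₁ hB₁ B₂ hB₂ _ _ huv]
        have : (τ : ℂ) + σ ≠ 0 := by exact_mod_cast h.ne'
        push_cast
        field_simp
    have hsmul : ∀ t : ℝ, 0 ≤ t → ∀ z ∈ K, (t : ℂ) * z ∈ K := by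
      rintro t ht _ ⟨τ, hτ, B₁, hB₁, rfl⟩
      refine ⟨t * τ, mul_nonneg ht hτ, B₁, hB₁, ?_⟩
      push_cast
      ring
    obtain ⟨μ, hμ, hμK⟩ := exists_im_mul_nonpos_of_cone (K := K) ⟨0, le_rfl, B, hB, by simp⟩ hadd
      hsmul huniv
    refine ⟨μ * κ ^ 2, mul_ne_zero hμ (pow_ne_zero 2 hκ), fun B' hB' ↦ ?_⟩
    have := hμK _ ⟨1, zero_le_one, B', hB', rfl⟩
    rwa [Complex.ofReal_one, mul_one, ← mul_assoc] at this

lemma chiUpper_of_pos {z : ℂ} (h : 0 < z.im) : chiUpper z = 1 :=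
  indicator_of_mem (s := {w : ℂ | 0 < w.im}) h 1

lemma chiUpper_of_nonpos {z : ℂ} (h : z.im ≤ 0) : chiUpper z = 0 :=
  indicator_of_notMem (s := {w : ℂ | 0 < w.im}) (not_lt.2 h) 1

lemma measurable_chiUpper : Measurable chiUpper :=
  measurable_one.indicator (measurableSet_lt measurable_const Complex.measurable_im)

lemma nonlinearStructure_mem_structures {b₁ b₂ : ℝ} (hb : b₁ ≤ b₂) {y : ℝ → ℂ}
    (hy : Continuous y) : nonlinearStructure b₁ b₂ y ∈ structures b₁ b₂ := by
  refine ⟨measurable_const.add (measurable_const.mul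
    (measurable_chiUpper.comp (hy.pow 2).measurable)), fun x ↦ ?_⟩
  unfold nonlinearStructure
  rcases lt_or_ge 0 (y x ^ 2).im with h | h
  · rw [chiUpper_of_pos h]
    constructor <;> linarith
  · rw [chiUpper_of_nonpos h]
    constructor <;> linarith

/-- The bang-bang property of structures that maximize a linear functional. -/
lemma eq_of_halfPlane {b₁ b₂ : ℝ} (hb : b₁ ≤ b₂) {B : ℝ → ℝ} (hB : B ∈ structures b₁ b₂)
    {y : ℝ → ℂ} (hy : Continuous y) {ν : ℂ}
    (h : ∀ B' ∈ structures b₁ b₂,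
      (ν ^ 2 * ∫ x in (0 : ℝ)..1, ((B' x : ℂ) - B x) * (y x * y x)).im ≤ 0) :
    ∀ᵐ x ∂(volume.restrict (Ioo (0 : ℝ) 1)), ((ν * y x) ^ 2).im ≠ 0 →
      nonlinearStructure b₁ b₂ (fun x ↦ ν * y x) x = B x := by
  have hνy : Continuous fun x ↦ ν * y x := continuous_const.mul hy
  set B' := nonlinearStructure b₁ b₂ (fun x ↦ ν * y x) with hB'd
  have hB' : B' ∈ structures b₁ b₂ := nonlinearStructure_mem_structures hb hνy
  have hfb : BddMeasurable fun x ↦ ((B' x : ℂ) - B x) * (ν * y x) ^ 2 :=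
    ((bddMeasurable_of_mem_structures hB').sub
      (bddMeasurable_of_mem_structures hB)).mul_continuous (hνy.pow 2)
  have him : ∀ x, (((B' x : ℂ) - B x) * (ν * y x) ^ 2).im =
      (B' x - B x) * ((ν * y x) ^ 2).im := fun x ↦ by
    rw [← Complex.ofReal_sub, Complex.im_ofReal_mul]
  have hnn : ∀ x, 0 ≤ (((B' x : ℂ) - B x) * (ν * y x) ^ 2).im := by
    intro x
    rw [him]
    have h1 := hB.2 x
    rcases lt_or_ge 0 ((ν * y x) ^ 2).im with hx | hx
    · have : B' x = b₂ := by simp [hB'd, nonlinearStructure, chiUpper_of_pos hx]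
      exact mul_nonneg (by linarith) hx.le
    · have : B' x = b₁ := by simp [hB'd, nonlinearStructure, chiUpper_of_nonpos hx]
      exact mul_nonneg_of_nonpos_of_nonpos (by linarith) hx
  have hI : IntegrableOn (fun x ↦ ((B' x : ℂ) - B x) * (ν * y x) ^ 2) (Ioo 0 1) :=
    hfb.integrableOn.mono_set Ioo_subset_Icc_self
  have hle : ∫ x in Ioo (0 : ℝ) 1, (((B' x : ℂ) - B x) * (ν * y x) ^ 2).im ≤ 0 := by
    have h1 := h B' hB'
    rw [← intervalIntegral.integral_const_mul, ← setIntegral_Ioo_eq] at h1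
    have h2 : ∫ x in Ioo (0 : ℝ) 1, ν ^ 2 * (((B' x : ℂ) - B x) * (y x * y x)) =
        ∫ x in Ioo (0 : ℝ) 1, ((B' x : ℂ) - B x) * (ν * y x) ^ 2 := by
      refine integral_congr_ae (Eventually.of_forall fun x ↦ ?_)
      simp only
      ring
    rw [h2] at h1
    have h3 := integral_im (𝕜 := ℂ) hI
    simp only [RCLike.im_to_complex] at h3
    rwa [h3]
  have hzero := (integral_eq_zero_iff_of_nonneg_ae (Eventually.of_forall hnn)
    hI.im).1
    -- The half-plane inequality at the maximizer `B'` bounds the integral of a nonnegative function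
    -- by zero.
    (le_antisymm hle (integral_nonneg hnn))
  filter_upwards [hzero] with x hx hne
  rw [him] at hx
  exact sub_eq_zero.1 ((mul_eq_zero.1 hx).resolve_right hne)

/-! ### The exceptional set where `Im (ν y)²` vanishes. -/

/-- The zeros of `Im (ν y)²` at which the argument of `y` is strictly monotone are isolated. -/
lemma countable_zeros {c : ℂ} {B y p : ℝ → ℂ} (h : IsODESol c B y p) {ν : ℂ} (hν : ν ≠ 0) :
    {x | ((ν * y x) ^ 2).im = 0 ∧ (p x * conj (y x)).im ≠ 0}.Countable := by
  set S : Set ℝ := {x | ((ν * y x) ^ 2).im = 0 ∧ (p x * conj (y x)).im ≠ 0} with hS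
  suffices hsub : S ⊆ {x ∈ S | 𝓝[S ∩ Ioi x] x = ⊥} from
    countable_setOfPred_isolated_right_within.mono hsub
  intro x hx
  refine ⟨hx, ?_⟩
  have hd : HasDerivAt (fun x ↦ ((ν * y x) ^ 2).im) (2 * ((ν * y x) * (ν * p x)).im) x := by
    have h1 := ((h.hasDerivAt x).const_mul ν).pow 2
    have h2 := Complex.imCLM.hasFDerivAt.comp_hasDerivAt x h1
    convert! h2 using 1
    simp [mul_assoc]
  have hne : 2 * ((ν * y x) * (ν * p x)).im ≠ 0 := by
    intro h0
    have h0' : ((ν * y x) * (ν * p x)).im = 0 := by linarith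
    -- If the derivative vanished too, both factors on the left would be real, and then so would `p
    -- x * conj (y x)`.
    have e : ((ν * y x) * (ν * p x)) * conj ((ν * y x) ^ 2) =
        ((Complex.normSq (ν * ν * y x) : ℝ) : ℂ) * (p x * conj (y x)) := by
      rw [← Complex.mul_conj]
      simp only [map_mul, map_pow]
      ring
    have e' := congrArg Complex.im e
    rw [Complex.im_ofReal_mul, Complex.mul_im, h0', Complex.conj_im, hx.1] at e'
    have hy : y x ≠ 0 := fun h ↦ hx.2 (by simp [h])
    have : Complex.normSq (ν * ν * y x) ≠ 0 := by simp [hν, hy]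
    exact mul_ne_zero this hx.2 (by rw [← e']; ring)
  have hev := hd.eventually_ne (c := 0) hne
  have hev' := hev.filter_mono (nhdsWithin_mono x fun z (hz : z ∈ S ∩ Ioi x) ↦ ne_of_gt hz.2)
  rw [← empty_mem_iff_bot]
  filter_upwards [hev', self_mem_nhdsWithin] with z h1 h2
  exact h1 h2.1.1

/-- At the last zero `a` of `Im (p ȳ)` the energy identity gives `∫₀ᵃ B |y|² = 0`. So `B y = 0`
almost everywhere on `(0, a)`, whence `p = 0` and `y = 1` there, and `B` itself vanishes almost
everywhere. All zeros of `Im (p ȳ)` in `[0,1]` lie in `[0, a]`. -/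
lemma ae_eq_zero_of_argument_const {c : ℂ} (hc : c.im ≠ 0) {b₁ b₂ : ℝ} (hb₁ : 0 ≤ b₁) {B : ℝ → ℝ}
    (hB : B ∈ structures b₁ b₂) {y p : ℝ → ℂ} (h : IsODESol c (fun x ↦ (B x : ℂ)) y p)
    (hy0 : y 0 = 1) (hp0 : p 0 = 0) :
    ∀ᵐ x ∂(volume.restrict (Ioo (0 : ℝ) 1)), (p x * conj (y x)).im = 0 → B x = 0 := by
  have h0 : (0 : ℝ) ∈ Icc (0 : ℝ) 1 := by simp
  have hBb := bddMeasurable_of_mem_structures hB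
  have hyc := h.continuous
  have hpc := h.continuous_deriv
  set S : Set ℝ := Icc 0 1 ∩ {x | (p x * conj (y x)).im = 0} with hS
  have hSc : IsCompact S := isCompact_Icc.inter_right (isClosed_eq (by fun_prop) continuous_const)
  have hSne : S.Nonempty := ⟨0, h0, by simp [hp0]⟩
  set a := sSup S with ha
  obtain ⟨ha1, ha2⟩ : a ∈ S := hSc.sSup_mem hSne
  have hWa : ∫ t in (0 : ℝ)..a, B t * Complex.normSq (y t) = 0 := by
    have h1 := congrArg Complex.im (h.energy hBb hp0 ha1)
    rw [show (p a * conj (y a)).im = 0 from ha2] at h1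
    simp only [Complex.sub_im, Complex.ofReal_im, Complex.im_mul_ofReal, zero_sub] at h1
    exact (mul_eq_zero.1 (neg_eq_zero.1 h1.symm)).resolve_left hc
  have hint : IntegrableOn (fun t ↦ B t * Complex.normSq (y t)) (Ioc 0 a) := by
    have h1 := (hBb.mul_continuous (g := fun t ↦ ((Complex.normSq (y t) : ℝ) : ℂ))
      (by fun_prop)).integrableOn.re
    have h2 : IntegrableOn (fun t ↦ B t * Complex.normSq (y t)) (Icc 0 1) := by
      simpa [IntegrableOn, ← Complex.ofReal_mul] using h1
    exact h2.mono_set (Ioc_subset_Icc_self.trans (Icc_subset_Icc_right ha1.2))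
  rw [intervalIntegral.integral_of_le ha1.1] at hWa
  have hz := (integral_eq_zero_iff_of_nonneg (fun t ↦
    mul_nonneg (hb₁.trans (hB.2 t).1) (Complex.normSq_nonneg _)) hint).1 hWa
  have hBy : ∀ᵐ t, t ∈ Ioc 0 a → -c * (B t : ℂ) * y t = 0 := by
    refine (ae_restrict_iff' measurableSet_Ioc).1 (hz.mono fun t ht ↦ ?_)
    rcases mul_eq_zero.1 ht with h1 | h1
    · simp [h1]
    · simp [Complex.normSq_eq_zero.1 h1]
  have hp : ∀ x ∈ Icc 0 a, p x = 0 := by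
    intro x hx
    rw [h.deriv_eq x ⟨hx.1, hx.2.trans ha1.2⟩, hp0, zero_add]
    refine intervalIntegral.integral_zero_ae (hBy.mono fun t ht ht' ↦ ht ?_)
    rw [uIoc_of_le hx.1] at ht'
    exact ⟨ht'.1, ht'.2.trans hx.2⟩
  have hy : ∀ x ∈ Icc 0 a, y x = 1 := by
    intro x hx
    rw [h.eq_integral x, hy0, add_eq_left]
    refine intervalIntegral.integral_zero_ae (Eventually.of_forall fun t ht ↦ hp t ?_)
    rw [uIoc_of_le hx.1] at ht
    exact ⟨ht.1.le, ht.2.trans hx.2⟩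
  filter_upwards [ae_restrict_of_ae hBy, ae_restrict_mem measurableSet_Ioo] with t ht ht01 htS
  have hta : t ≤ a := le_csSup hSc.bddAbove ⟨Ioo_subset_Icc_self ht01, htS⟩
  have h1 := ht ⟨ht01.1, hta⟩
  rw [hy t ⟨ht01.1.le, hta⟩, mul_one] at h1
  have hc0 : c ≠ 0 := fun h ↦ hc (by simp [h])
  simpa [hc0] using h1

/-! ### Nonzero frequency. -/

/-- A solution whose nonlinear structure agrees with its potential proves the theorem. -/
lemma exists_optimal_of_isODESol {b₁ b₂ α : ℝ} (hb : b₁ ≤ b₂) {κ : ℂ}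
    (hκ : IsOptimalQuasiEigenvalue b₁ b₂ α κ) (hκ0 : κ ≠ 0) {B : ℝ → ℝ}
    (hB : B ∈ structures b₁ b₂) {y p : ℝ → ℂ} (h : IsODESol (κ ^ 2) (fun x ↦ (B x : ℂ)) y p)
    (hy0 : y 0 ≠ 0) (hp0 : p 0 = 0) (hp1 : p 1 = -Complex.I * κ * y 1)
    (hBy : nonlinearStructure b₁ b₂ y =ᵐ[volume.restrict (Ioo 0 1)] B) :
    ∃ y : ℝ → ℂ, (∃ x ∈ Icc (0 : ℝ) 1, y x ≠ 0) ∧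
      IsSolution κ (nonlinearStructure b₁ b₂ y) y ∧
      IsOptimalStructure b₁ b₂ α (nonlinearStructure b₁ b₂ y) := by
  have hs := h.isSolution hκ0 (bddMeasurable_of_mem_structures hB) hBy hp0 hp1
  have hne : ∃ x ∈ Icc (0 : ℝ) 1, y x ≠ 0 := ⟨0, by simp, hy0⟩
  exact ⟨y, hne, hs, structures_subset_admissible _ _
    (nonlinearStructure_mem_structures hb h.continuous), κ, ⟨hκ0, y, hs, hne⟩, hκ⟩

/-- An optimal quasi-eigenvalue has a normalized eigenfunction for a regular structure. -/
lemma IsOptimalQuasiEigenvalue.exists_isODESol {b₁ b₂ α : ℝ} (hb : b₁ ≤ b₂) {κ : ℂ}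
    (hκ : IsOptimalQuasiEigenvalue b₁ b₂ α κ) :
    κ ≠ 0 ∧ ∃ B ∈ structures b₁ b₂, ∃ y p, IsODESol (κ ^ 2) (fun x ↦ (B x : ℂ)) y p ∧
      y 0 = 1 ∧ p 0 = 0 ∧ p 1 = -Complex.I * κ * y 1 ∧ y 1 ≠ 0 := by
  obtain ⟨hre, ⟨B, hB, κ', ⟨hκ0, y, hy, x, hx, hyx⟩, hre', him⟩, -⟩ := hκ
  obtain rfl : κ' = κ := Complex.ext (hre'.trans hre.symm) him
  obtain ⟨B₀, hB₀, hBB⟩ := exists_mem_structures hb hB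
  have hB₀b := bddMeasurable_of_mem_structures hB₀
  obtain ⟨Y, P, hs, hYy, hP0, hP1⟩ := hy.exists_isODESol hκ0 hB₀b hBB
  have hYx : Y x ≠ 0 := by rwa [hYy hx]
  have hY0 : Y 0 ≠ 0 := fun h ↦ hYx (hs.eq_zero_of_initial hB₀b h hP0 x hx)
  have hY1 : Y 1 ≠ 0 := fun h ↦ hYx (hs.eq_zero_of_terminal hB₀b h (by simp [hP1, h]) x hx)
  refine ⟨hκ0, B₀, hB₀, _, _, hs.const_mul (Y 0)⁻¹, inv_mul_cancel₀ hY0, by simp [hP0], ?_,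
    mul_ne_zero (inv_ne_zero hY0) hY1⟩
  simp only [hP1]
  ring

theorem exists_optimal_of_re_ne_zero {b₁ b₂ α : ℝ} (hb₁ : 0 ≤ b₁) (hb : b₁ ≤ b₂) (hα : α ≠ 0)
    {κ : ℂ} (hκ : IsOptimalQuasiEigenvalue b₁ b₂ α κ) :
    ∃ y : ℝ → ℂ, (∃ x ∈ Icc (0 : ℝ) 1, y x ≠ 0) ∧
      IsSolution κ (nonlinearStructure b₁ b₂ y) y ∧
      IsOptimalStructure b₁ b₂ α (nonlinearStructure b₁ b₂ y) := by
  obtain ⟨hκ0, B, hB, y, p, h, hy0, hp0, hp1, hy1⟩ := hκ.exists_isODESol hb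
  have hBb := bddMeasurable_of_mem_structures hB
  -- This also excludes real `κ`: at `x = 1` the left side of the energy identity has imaginary part
  -- `-α |y 1|²`, while real `κ²` would make the right side real.
  have hc : (κ ^ 2).im ≠ 0 := by
    intro hc
    have h1 := congrArg Complex.im (h.energy hBb hp0 (x := 1) (by simp))
    have e : p 1 * conj (y 1) = ((Complex.normSq (y 1) : ℝ) : ℂ) * (-Complex.I * κ) := by
      rw [hp1, ← Complex.mul_conj]
      ring
    rw [e, Complex.im_ofReal_mul, Complex.sub_im, Complex.ofReal_im, Complex.im_mul_ofReal, hc,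
      zero_mul, sub_zero] at h1
    rcases mul_eq_zero.1 h1 with h2 | h2
    · exact hy1 (Complex.normSq_eq_zero.1 h2)
    · refine hα (hκ.1 ▸ ?_)
      simpa using h2
  rcases span_or_halfPlane hκ0 hB h.continuous with hspan | ⟨μ, hμ, hhalf⟩
  · exfalso
    obtain ⟨B', hB', κ', hκ', hre, him⟩ :=
      exists_lower_quasiEigenvalue hκ0 hB h hy0 hp0 hp1 hy1 hspan
    exact absurd (hκ.2.2 ⟨B', structures_subset_admissible _ _ hB', κ', hκ', hre.trans hκ.1, rfl⟩)
      (not_le.2 him)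
  · obtain ⟨ν, rfl⟩ := IsAlgClosed.exists_pow_nat_eq μ two_pos
    have hν : ν ≠ 0 := fun h ↦ hμ (by simp [h])
    refine exists_optimal_of_isODESol hb hκ hκ0 hB (h.const_mul ν) (by simpa [hy0] using hν)
      (by simp [hp0]) (by simp only [hp1]; ring) ?_
    filter_upwards [eq_of_halfPlane hb hB h.continuous hhalf,
      ae_eq_zero_of_argument_const hc hb₁ hB h hy0 hp0,
      ae_restrict_of_ae ((countable_zeros h hν).ae_notMem volume)] with x hx1 hx2 hx3
    by_cases hx : ((ν * y x) ^ 2).im = 0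
    · have hW : (p x * conj (y x)).im = 0 := by
        by_contra hW
        exact hx3 ⟨hx, hW⟩
      -- Here `0 ≤ b₁ ≤ B x = 0`, so the nonlinear structure takes the same value `b₁ = 0`.
      have hBx := hx2 hW
      have := (hB.2 x).1
      unfold nonlinearStructure
      rw [chiUpper_of_nonpos hx.le, hBx]
      linarith
    · exact hx1 hx

/-! ### Zero frequency: comparison with the constant structure `b₂`. -/

/-- For a real spectral parameter the real part of a solution is a solution. -/
lemma IsODESol.re {c : ℝ} {B : ℝ → ℝ} {y p : ℝ → ℂ}
    (h : IsODESol (c : ℂ) (fun x ↦ (B x : ℂ)) y p) (hB : BddMeasurable fun x ↦ (B x : ℂ)) :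
    IsODESol (c : ℂ) (fun x ↦ (B x : ℂ)) (fun x ↦ ((y x).re : ℂ)) (fun x ↦ ((p x).re : ℂ)) where
  hasDerivAt x := by
    have := Complex.reCLM.hasFDerivAt.comp_hasDerivAt x (h.hasDerivAt x)
    exact HasDerivAt.ofReal_comp (f := fun x ↦ (y x).re) this
  continuous_deriv := by
    have := h.continuous_deriv
    fun_prop
  deriv_eq x hx := by
    have h0 : (0 : ℝ) ∈ Icc (0 : ℝ) 1 := by simp
    rw [h.deriv_eq x hx, Complex.add_re, Complex.ofReal_add, add_right_inj]
    have h1 := Complex.reCLM.intervalIntegral_comp_comm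
      ((h.bddMeasurable hB).intervalIntegrable h0 hx)
    simp only [Complex.reCLM_apply] at h1
    rw [← h1, ← intervalIntegral.integral_ofReal]
    refine intervalIntegral.integral_congr fun t _ ↦ ?_
    rw [← Complex.ofReal_neg, ← Complex.ofReal_mul, Complex.re_ofReal_mul]
    push_cast
    ring

/-- For a nonpositive real spectral parameter the real part of the normalized solution is positive,
and its square is nondecreasing. -/
lemma IsODESol.re_pos_of_nonpos {c : ℝ} (hc : c ≤ 0) {b₁ b₂ : ℝ} (hb₁ : 0 ≤ b₁) {B : ℝ → ℝ}
    (hB : B ∈ structures b₁ b₂) {y p : ℝ → ℂ} (h : IsODESol (c : ℂ) (fun x ↦ (B x : ℂ)) y p)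
    (hy0 : y 0 = 1) (hp0 : p 0 = 0) :
    ∀ x ∈ Icc (0 : ℝ) 1, 0 < (y x).re ∧ 0 ≤ (p x).re * (y x).re := by
  have hBb := bddMeasurable_of_mem_structures hB
  have hr := h.re hBb
  have hd : ∀ x, HasDerivAt (fun x ↦ (y x).re) (p x).re x := fun x ↦
    Complex.reCLM.hasFDerivAt.comp_hasDerivAt x (h.hasDerivAt x)
  have hprod : ∀ x ∈ Icc (0 : ℝ) 1, 0 ≤ (p x).re * (y x).re := by
    intro x hx
    -- For `c ≤ 0` both contributions to the energy identity are nonnegative.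
    have h1 := hr.energy hBb (by simp [hp0]) hx
    rw [Complex.conj_ofReal, ← Complex.ofReal_mul, ← Complex.ofReal_mul, ← Complex.ofReal_sub,
      Complex.ofReal_inj] at h1
    rw [h1, sub_nonneg]
    refine (mul_nonpos_of_nonpos_of_nonneg hc ?_).trans ?_
    · exact intervalIntegral.integral_nonneg hx.1 fun t _ ↦
        mul_nonneg (hb₁.trans (hB.2 t).1) (Complex.normSq_nonneg _)
    · exact intervalIntegral.integral_nonneg hx.1 fun t _ ↦ Complex.normSq_nonneg _
  have hcont : Continuous fun x ↦ (y x).re := Complex.continuous_re.comp h.continuous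
  have hmono : MonotoneOn (fun x ↦ (y x).re ^ 2) (Icc 0 1) := by
    refine monotoneOn_of_hasDerivWithinAt_nonneg (convex_Icc 0 1) (hcont.pow 2).continuousOn
      (fun x _ ↦ ((hd x).pow 2).hasDerivWithinAt) fun x hx ↦ ?_
    have := hprod x (interior_subset hx)
    simp only [Nat.cast_ofNat, Nat.add_one_sub_one, pow_one]
    nlinarith
  have hne : ∀ x ∈ Icc (0 : ℝ) 1, (y x).re ≠ 0 := by
    intro x hx hzero
    have := hmono (by simp : (0 : ℝ) ∈ Icc (0 : ℝ) 1) hx hx.1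
    simp only [hy0, hzero] at this
    norm_num at this
  refine fun x hx ↦ ⟨?_, hprod x hx⟩
  by_contra hneg
  obtain ⟨z, hz, hz0⟩ := intermediate_value_Icc' hx.1 hcont.continuousOn
    (⟨not_lt.1 hneg, by simp [hy0]⟩ : (0 : ℝ) ∈ Icc (y x).re (y 0).re)
  exact hne z ⟨hz.1, hz.2.trans hx.2⟩ hz0

/-- The hyperbolic cosine solves the system with a constant potential. -/
lemma isODESol_cosh (t r : ℝ) :
    IsODESol ((Complex.I * t) ^ 2) (fun _ ↦ ((r ^ 2 : ℝ) : ℂ))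
      (fun x ↦ (Real.cosh (t * r * x) : ℂ)) (fun x ↦ ((t * r * Real.sinh (t * r * x) : ℝ) : ℂ)) := by
  have hl : ∀ x : ℝ, HasDerivAt (fun x ↦ t * r * x) (t * r) x := fun x ↦ by
    simpa using (hasDerivAt_id x).const_mul (t * r)
  have hc : ∀ x, HasDerivAt (fun x ↦ Real.cosh (t * r * x)) (t * r * Real.sinh (t * r * x)) x :=
    fun x ↦ by simpa [mul_comm] using (hl x).cosh
  have hs : ∀ x, HasDerivAt (fun x ↦ t * r * Real.sinh (t * r * x))
      ((t * r) ^ 2 * Real.cosh (t * r * x)) x := fun x ↦ by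
    have := ((hl x).sinh).const_mul (t * r)
    convert! this using 1
    ring
  refine ⟨fun x ↦ (hc x).ofReal_comp, by fun_prop, fun x _ ↦ ?_⟩
  have h1 : ∫ s in (0 : ℝ)..x, -(Complex.I * t) ^ 2 * ((r ^ 2 : ℝ) : ℂ) *
      (Real.cosh (t * r * s) : ℂ) =
      ∫ s in (0 : ℝ)..x, (((t * r) ^ 2 * Real.cosh (t * r * s) : ℝ) : ℂ) := by
    refine intervalIntegral.integral_congr fun s _ ↦ ?_
    push_cast
    linear_combination (-(t : ℂ) ^ 2 * r ^ 2 * Complex.cosh (t * r * s)) * Complex.I_sq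
  rw [h1, intervalIntegral.integral_eq_sub_of_hasDerivAt (fun s _ ↦ (hs s).ofReal_comp)
    (Continuous.intervalIntegrable (by fun_prop) _ _)]
  ring

/-- Now `κ²` is real, so the energy identity no longer controls the set `Im (ν y)² = 0`. Positivity
of `Re y` allows a direct comparison with `cosh` instead. -/
theorem exists_optimal_of_re_eq_zero {b₁ b₂ : ℝ} (hb₁ : 0 ≤ b₁) (hb : b₁ < b₂)
    {κ : ℂ} (hκ : IsOptimalQuasiEigenvalue b₁ b₂ 0 κ) :
    ∃ y : ℝ → ℂ, (∃ x ∈ Icc (0 : ℝ) 1, y x ≠ 0) ∧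
      IsSolution κ (nonlinearStructure b₁ b₂ y) y ∧
      IsOptimalStructure b₁ b₂ 0 (nonlinearStructure b₁ b₂ y) := by
  obtain ⟨hκ0, B, hB, y, p, h, hy0, hp0, hp1, hy1⟩ := hκ.exists_isODESol hb.le
  have hBb := bddMeasurable_of_mem_structures hB
  have hm : (1 : ℝ) ∈ Icc (0 : ℝ) 1 := by simp
  obtain ⟨β, rfl⟩ : ∃ β : ℝ, κ = Complex.I * β := ⟨κ.im, Complex.ext (by simp [hκ.1]) (by simp)⟩
  have hβ0 : β ≠ 0 := fun h ↦ hκ0 (by simp [h])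
  have hc : (Complex.I * β) ^ 2 = ((-β ^ 2 : ℝ) : ℂ) := by
    push_cast
    linear_combination (β : ℂ) ^ 2 * Complex.I_sq
  have hre := (hc ▸ h).re_pos_of_nonpos (by nlinarith [sq_nonneg β]) hb₁ hB hy0 hp0
  have hp1' : p 1 = β * y 1 := by
    rw [hp1]
    linear_combination (-(β : ℂ) * y 1) * Complex.I_sq
  -- At `1` the boundary condition turns the nonnegative product `(p 1).re * (y 1).re` into `β (y
  -- 1).re ^ 2`.
  have hβ : 0 < β := by
    obtain ⟨h1, h2⟩ := hre 1 hm
    rw [hp1', Complex.re_ofReal_mul, mul_assoc] at h2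
    exact lt_of_le_of_ne (nonneg_of_mul_nonneg_left h2 (mul_pos h1 h1)) hβ0.symm
  set r := Real.sqrt b₂ with hr
  have hr2 : r ^ 2 = b₂ := Real.sq_sqrt (hb₁.trans hb.le)
  have hconst : (fun _ ↦ r ^ 2) ∈ structures b₁ b₂ :=
    ⟨measurable_const, fun _ ↦ by rw [hr2]; exact ⟨hb.le, le_rfl⟩⟩
  have hcb := bddMeasurable_of_mem_structures hconst
  -- The Wronskian of `y` and `cosh (β r x)` has real part `β (y 1).re (cosh (β r) - r sinh (β r))`
  -- at `1`, and this is the integral of `-β² (b₂ - B) cosh (β r x) Re y ≤ 0`.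
  have hineq : Real.cosh (β * r) ≤ r * Real.sinh (β * r) := by
    have hw := h.wronskian (isODESol_cosh β r) hBb hcb hm
    have hLHS : ∫ t in (0 : ℝ)..1, ((Complex.I * β) ^ 2 * ((r ^ 2 : ℝ) : ℂ) -
        (Complex.I * β) ^ 2 * (B t : ℂ)) * (y t * (Real.cosh (β * r * t) : ℂ)) =
        ∫ t in (0 : ℝ)..1, ((-β ^ 2 * (b₂ - B t) * Real.cosh (β * r * t) : ℝ) : ℂ) * y t := by
      refine intervalIntegral.integral_congr fun t _ ↦ ?_
      rw [hc, hr2]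
      push_cast
      ring
    have hint : BddMeasurable fun t ↦
        ((-β ^ 2 * (b₂ - B t) * Real.cosh (β * r * t) : ℝ) : ℂ) * y t := by
      have h1 := ((((BddMeasurable.of_continuous (continuous_const (y := (b₂ : ℂ)))).sub
        hBb).const_mul (-(β : ℂ) ^ 2)).mul_continuous
        (g := fun t ↦ (Real.cosh (β * r * t) : ℂ)) (by fun_prop)).mul_continuous h.continuous
      convert! h1 using 2
      push_cast
      ring
    have hre' := Complex.reCLM.intervalIntegral_comp_comm
      (hint.intervalIntegrable (a := 0) (b := 1) (by simp) hm)
    rw [hLHS] at hw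
    rw [hw, hp1', hp0] at hre'
    have hle : ∫ t in (0 : ℝ)..1, Complex.reCLM
        (((-β ^ 2 * (b₂ - B t) * Real.cosh (β * r * t) : ℝ) : ℂ) * y t) ≤ 0 := by
      rw [← neg_nonneg, ← intervalIntegral.integral_neg]
      refine intervalIntegral.integral_nonneg zero_le_one fun t ht ↦ ?_
      rw [Complex.reCLM_apply, Complex.re_ofReal_mul]
      have h1 : 0 ≤ β ^ 2 * (b₂ - B t) * Real.cosh (β * r * t) * (y t).re :=
        mul_nonneg (mul_nonneg (mul_nonneg (sq_nonneg _) (sub_nonneg.2 (hB.2 t).2))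
          (Real.cosh_pos _).le) (hre t ht).1.le
      linarith
    rw [hre'] at hle
    have heq : (Complex.reCLM (β * y 1 * (Real.cosh (β * r * 1) : ℂ) -
        y 1 * ((β * r * Real.sinh (β * r * 1) : ℝ) : ℂ) -
        (0 * (Real.cosh (β * r * 0) : ℂ) - y 0 * ((β * r * Real.sinh (β * r * 0) : ℝ) : ℂ)))) =
        β * (y 1).re * (Real.cosh (β * r) - r * Real.sinh (β * r)) := by
      rw [mul_one, mul_zero, Real.sinh_zero, mul_zero, Complex.ofReal_zero, mul_zero, zero_mul,
        sub_zero, sub_zero, Complex.reCLM_apply, Complex.sub_re, mul_assoc, Complex.re_ofReal_mul,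
        Complex.re_mul_ofReal, Complex.re_mul_ofReal]
      ring
    rw [heq] at hle
    exact sub_nonpos.1 (nonpos_of_mul_nonpos_right hle (mul_pos hβ (hre 1 hm).1))
  -- The equation `r sinh (t r) = cosh (t r)` says that `I t` is a quasi-eigenvalue of the constant
  -- `b₂`; the difference is `-1` at `t = 0` and nonnegative at `t = β`.
  obtain ⟨t, ht, ht0⟩ := intermediate_value_Icc hβ.le
    (f := fun t ↦ r * Real.sinh (t * r) - Real.cosh (t * r)) (by fun_prop)
    (⟨by simp, sub_nonneg.2 hineq⟩ : (0 : ℝ) ∈ Icc _ _)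
  have htpos : t ≠ 0 := by
    rintro rfl
    simp at ht0
  have hcosh := isODESol_cosh t r
  have htp1 : ((t * r * Real.sinh (t * r * 1) : ℝ) : ℂ) =
      -Complex.I * (Complex.I * t) * (Real.cosh (t * r * 1) : ℂ) := by
    rw [mul_one, ← sub_eq_zero.1 ht0]
    push_cast
    linear_combination (t * (r * Complex.sinh (t * r)) : ℂ) * Complex.I_sq
  have htκ : Complex.I * (t : ℂ) ≠ 0 := by simpa using htpos
  have hmem : Complex.I * (t : ℂ) ∈ quasiEigenvalues fun _ ↦ r ^ 2 :=
    ⟨htκ, _, hcosh.isSolution htκ hcb (EventuallyEq.refl _ _) (by simp) htp1, 0, by simp, by simp⟩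
  have hβt : β ≤ t := by
    have := hκ.2.2 ⟨_, structures_subset_admissible _ _ hconst, _, hmem, by simp, rfl⟩
    simpa using this
  obtain rfl : t = β := le_antisymm ht.2 hβt
  -- With `ν² = I` the square of `ν cosh` lies on the positive imaginary axis, so the nonlinear
  -- structure is `b₂` everywhere.
  obtain ⟨ν, hν⟩ := IsAlgClosed.exists_pow_nat_eq Complex.I two_pos
  have hν0 : ν ≠ 0 := fun h ↦ Complex.I_ne_zero (by simp [← hν, h])
  refine exists_optimal_of_isODESol hb.le hκ htκ hconst (hcosh.const_mul ν) (by simpa using hν0)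
    (by simp) (by rw [htp1]; ring) (Eventually.of_forall fun x ↦ ?_)
  have him : 0 < ((ν * (Real.cosh (t * r * x) : ℂ)) ^ 2).im := by
    rw [mul_pow, hν, ← Complex.ofReal_pow, Complex.im_mul_ofReal, Complex.I_im, one_mul]
    exact pow_pos (Real.cosh_pos _) 2
  simp only [nonlinearStructure]
  rw [chiUpper_of_pos him, hr2]
  ring

end QuasiNormal

theorem theorem2p4 (b₁ b₂ : ℝ) (hb₁ : 0 ≤ b₁) (hb : b₁ < b₂) (α : ℝ) (κ : ℂ)
    (hκ : QuasiNormal.IsOptimalQuasiEigenvalue b₁ b₂ α κ) :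
    ∃ y : ℝ → ℂ,
      (∃ x ∈ Icc (0 : ℝ) 1, y x ≠ 0) ∧
      QuasiNormal.IsSolution κ (QuasiNormal.nonlinearStructure b₁ b₂ y) y ∧
      QuasiNormal.IsOptimalStructure b₁ b₂ α (QuasiNormal.nonlinearStructure b₁ b₂ y) := by
  rcases eq_or_ne α 0 with rfl | hα
  · exact QuasiNormal.exists_optimal_of_re_eq_zero hb₁ hb hκ
  · exact QuasiNormal.exists_optimal_of_re_ne_zero hb₁ hb.le hα hκ
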